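/- Let $0<\alpha<\frac12$, $0<\kappa<\frac12$ and $0<\beta<\frac{\alpha\kappa}{41}$, let $A_1$ be a real number, let $\epsilon\mapsto A_2(\epsilon)$ and $\epsilon\mapsto A_3(\epsilon)$ be real-valued functions of $\epsilon>0$, and let $\epsilon_0>0$. Then there are real numbers $C$ and $x_0$, depending only on $\alpha,\kappa,\beta,A_1,A_2(\cdot),A_3(\cdot),\epsilon_0$, such that the following holds for every real $x\ge x_0$. Let $f$ be a nonnegative multiplicative arithmetic function (which may depend on $x$) such that 1. $f(p^l)\le A_1^l(\log\log x)^{\beta l}$ for every prime $p$ and every integer $l\ge1$; 2. $f(n)\le\max\{A_2(\epsilon)\,n^{\epsilon},\,A_3(\epsilon)(\log x)^{\epsilon}\}$ for every $\epsilon>0$ and every integer $n\ge1$. Then for every real $y$ with $x^\kappa\le y\le x$, every positive integer $k<y^{1-\alpha}$ and every integer $a$ with $(a,k)=1$, $$\sum_{\substack{x\le n\le x+y\\ n\equiv a\pmod k}}f(n)\le C\,\frac{x}{\phi(k)(\log x)^{1-\epsilon_0}}\exp\left(\sum_{\substack{p\le x\\ p\nmid k}}\frac{f(p)}{p}\right),$$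 where $\phi$ is Euler's function and $p$ runs over primes. -/

import Mathlib

/-- Membership in the class `M(β)` at the scale `x`, with the constants made explicit: `f` is a
nonnegative multiplicative arithmetic function (it may depend on `x`) such that
* `f (p ^ l) ≤ A₁ ^ l * (log log x) ^ (β * l)` for every prime `p` and every `l ≥ 1`;
* for every `ε > 0` and every `n ≥ 1`, `f n ≤ max (A₂(ε) * n ^ ε) (A₃(ε) * (log x) ^ ε)`.
The constants `A₁`, `A₂(ε)`, `A₃(ε)` are parameters, so that they can be fixed before `x`. -/
structure MemShiuClass (β A₁ : ℝ) (A₂ A₃ : ℝ → ℝ) (x : ℝ) (f : ArithmeticFunction ℝ) : Prop where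
  isMultiplicative : f.IsMultiplicative
  nonneg : ∀ n : ℕ, 0 ≤ f n
  prime_pow_le : ∀ p l : ℕ, p.Prime → 1 ≤ l →
    f (p ^ l) ≤ A₁ ^ l * (Real.log (Real.log x)) ^ (β * (l : ℝ))
  le_max : ∀ ε : ℝ, 0 < ε → ∀ n : ℕ, 1 ≤ n →
    f n ≤ max (A₂ ε * (n : ℝ) ^ ε) (A₃ ε * (Real.log x) ^ ε)

/-- The sum of `f n` over the natural numbers `n` with `x ≤ n ≤ x + y` and `n ≡ a (mod k)`
(for `x` positive and `y` nonnegative). -/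
noncomputable def shortProgressionSum (f : ArithmeticFunction ℝ) (x y : ℝ) (k : ℕ) (a : ℤ) : ℝ :=
  ∑ n ∈ (Finset.Icc ⌈x⌉₊ ⌊x + y⌋₊).filter (fun n : ℕ => (n : ℤ) ≡ a [ZMOD (k : ℤ)]), f n

/-- The sum of `f p / p` over the primes `p ≤ x` that do not divide `k`. -/
noncomputable def primeSumCoprime (f : ArithmeticFunction ℝ) (x : ℝ) (k : ℕ) : ℝ :=
  ∑ p ∈ (Finset.Icc 1 ⌊x⌋₊).filter (fun p : ℕ => p.Prime ∧ ¬ p ∣ k), f p / (p : ℝ)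

/-! Write u = log log x. The bound involves x and not y, so the sum may be extended to all of [x,
2x], and k enters only through k < x^(1-α). The method is Shiu's. Put M = (2x)^(α/10). Cutting n at
a suitable prime q (`exists_coprime_factorization_or_sq_dvd`) gives either a square m² ∣ n with M <
m ≤ M², or n = bd with the primes of b below q, those of d at least q, b ≤ M⁵ and bq > M. Large
squares, and the b that occur with q below about u⁴, are so rare that the pointwise bound f(n) ≪
x^(α/80) disposes of them.

The other n are sorted by r, the integer part of log N / log q, where N = ⌊2x⌋. Then d has at most r
prime factors, so f(d) ≤ B^r with B a constant times u^β. The condition bq > M is exploited as in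
Rankin's method: with U = u^(1/2), λ = log U / log 2x and δ = rλ one has q^δ ≤ U, hence 1 ≤ (bq/M)^δ
≤ b^δ U M^(-δ) and f(n) ≤ (B M^(-λ))^r U f(b) b^δ. Since M^(-λ) = u^(-α/20) and β < α/20, the sum
over r is dominated by a geometric series of small ratio (`sum_dyadicClass_rough_cofactor_le`).

For r ≤ h = ⌈17u⌉, d has no prime factor below Y = ⌊x^(α/(8h))⌋, and Brun's pure sieve saves log Y ≫
(log x)/u. For r > h the geometric factor alone saves log x. What remains is the sum of f(b)
b^(δ-1), which an Euler product bounds by exp(∑ f(p)/p) up to an arbitrarily small power of log x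
(`sum_rankin_le_exp`, `sum_rankin_le_of_large`); only p ∤ k occur because n is coprime to k. All
losses are powers of u or small powers of log x, absorbed by (log x)^ε₀. -/

open Finset

/-! ### Brun's pure sieve -/

theorem sum_neg_one_pow_card_le_ge {ι : Type*} [DecidableEq ι] (S : Finset ι) (h : ℕ) :
    (if S = ∅ then (1 : ℝ) else 0) ≤
      ∑ T ∈ S.powerset with T.card ≤ 2 * h, (-1 : ℝ) ^ T.card := by
  rw [sum_filter, sum_powerset_apply_card (fun j => if j ≤ 2 * h then (-1 : ℝ) ^ j else 0)]
  have key : ∑ m ∈ range (S.card + 1), S.card.choose m • (if m ≤ 2 * h then (-1 : ℝ) ^ m else 0) =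
      ((∑ m ∈ range (2 * h + 1), ((-1) ^ m * S.card.choose m : ℤ) : ℤ) : ℝ) := by
    push_cast
    have e1 : ∑ m ∈ range (S.card + 1),
        S.card.choose m • (if m ≤ 2 * h then (-1 : ℝ) ^ m else 0) =
        ∑ m ∈ range (S.card + 2 * h + 1),
          S.card.choose m • (if m ≤ 2 * h then (-1 : ℝ) ^ m else 0) := by
      refine sum_subset (by intro m; simp only [mem_range]; omega) fun m _ hm => ?_
      rw [Nat.choose_eq_zero_of_lt (by simpa using hm), zero_smul]
    have e2 : ∑ m ∈ range (2 * h + 1), (-1 : ℝ) ^ m * (S.card.choose m : ℝ) =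
        ∑ m ∈ range (S.card + 2 * h + 1),
          S.card.choose m • (if m ≤ 2 * h then (-1 : ℝ) ^ m else 0) := by
      refine (sum_congr rfl fun m hm => ?_).trans
        (sum_subset (by intro m; simp only [mem_range]; omega) fun m _ hm => ?_)
      · rw [if_pos (by simp at hm; omega), nsmul_eq_mul, mul_comm]
      · rw [if_neg (by simp at hm; omega), smul_zero]
    rw [e1, e2]
  rw [key]
  split_ifs with hS
  · subst hS
    rw [sum_range_succ']
    simp
  · obtain ⟨s, hs⟩ : ∃ s, S.card = s + 1 := Nat.exists_eq_succ_of_ne_zero (by simpa using hS)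
    -- An alternating row of binomial coefficients cut at the even index 2h sums to a single
    -- binomial coefficient with sign +1.
    rw [hs, Int.alternating_sum_range_choose_eq_choose]
    simp

theorem card_powerset_card_le {ι : Type*} (S : Finset ι) (h : ℕ) :
    ((S.powerset.filter (fun T => T.card ≤ h)).card : ℝ) ≤ ((S.card : ℝ) + 1) ^ h := by
  have : (S.powerset.filter (fun T => T.card ≤ h)).card ≤ (S.card + 1) ^ h := by
    rw [card_filter, sum_powerset_apply_card (fun j => if j ≤ h then 1 else 0), add_pow]
    have e1 : ∑ m ∈ range (S.card + 1), S.card.choose m • (if m ≤ h then 1 else 0) ≤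
        ∑ m ∈ range (S.card + h + 1), S.card.choose m • (if m ≤ h then 1 else 0) :=
      sum_le_sum_of_subset (by intro m; simp only [mem_range]; omega)
    have e2 : ∑ m ∈ range (h + 1), S.card.choose m =
        ∑ m ∈ range (S.card + h + 1), S.card.choose m • (if m ≤ h then 1 else 0) := by
      refine (sum_congr rfl fun m hm => ?_).trans
        (sum_subset (by intro m; simp only [mem_range]; omega) fun m _ hm => ?_)
      · rw [if_pos (by simp at hm; omega)]; simp
      · rw [if_neg (by simp at hm; omega)]; simp
    refine e1.trans (e2 ▸ sum_le_sum fun m hm => ?_)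
    have h1 := Nat.choose_le_pow S.card m
    have h2 : 0 < h.choose m := Nat.choose_pos (by simp at hm; omega)
    simp only [one_pow, mul_one, Nat.cast_id]
    nlinarith [Nat.zero_le (S.card ^ m)]
  exact_mod_cast this

/-- Brun's pure sieve. -/
theorem brun_pure_sieve {ι γ : Type*} (A : Finset γ) (P : Finset ι)
    (R : ι → γ → Prop) [∀ p n, Decidable (R p n)] (g : ι → ℝ) (hg : ∀ p ∈ P, 0 ≤ g p) (W E : ℝ) (hW : 0 ≤ W)
    (h : ℕ) (hcount : ∀ T ⊆ P,
      |((A.filter (fun n => ∀ p ∈ T, R p n)).card : ℝ) - W * ∏ p ∈ T, g p| ≤ E) :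
    ((A.filter (fun n => ∀ p ∈ P, ¬ R p n)).card : ℝ) ≤
      W * (∏ p ∈ P, (1 - g p) + (1 / 4) ^ h * Real.exp (2 * ∑ p ∈ P, g p)) +
        E * ((P.card : ℝ) + 1) ^ (2 * h) := by
  classical
  set F := P.powerset.filter (fun T => T.card ≤ 2 * h) with hF
  have step1 : ((A.filter (fun n => ∀ p ∈ P, ¬ R p n)).card : ℝ) ≤
      ∑ n ∈ A, ∑ T ∈ F, if (∀ p ∈ T, R p n) then (-1 : ℝ) ^ T.card else 0 := by
    rw [card_filter]
    push_cast
    refine sum_le_sum fun n _ => ?_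
    have := sum_neg_one_pow_card_le_ge (P.filter (fun p => R p n)) h
    have e : F.filter (fun T => ∀ p ∈ T, R p n) =
        ((P.filter (fun p => R p n)).powerset.filter (fun T => T.card ≤ 2 * h)) := by
      ext T
      simp only [hF, mem_filter, mem_powerset, subset_iff]
      grind
    rw [← sum_filter, e]
    refine le_trans (le_of_eq ?_) this
    refine if_congr ?_ rfl rfl
    rw [filter_eq_empty_iff]
  have step2 : ∑ n ∈ A, ∑ T ∈ F, (if (∀ p ∈ T, R p n) then (-1 : ℝ) ^ T.card else 0) ≤
      ∑ T ∈ F, ((-1 : ℝ) ^ T.card * (W * ∏ p ∈ T, g p) + E) := by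
    rw [sum_comm]
    refine sum_le_sum fun T hT => ?_
    have hT' := hcount T (mem_powerset.1 (mem_filter.1 hT).1)
    rw [← sum_filter, sum_const, nsmul_eq_mul]
    rw [abs_le] at hT'
    rcases neg_one_pow_eq_or ℝ T.card with h1 | h1 <;> rw [h1] <;> linarith [hT'.1, hT'.2]
  refine step1.trans (step2.trans ?_)
  rw [sum_add_distrib, sum_const, nsmul_eq_mul, mul_comm _ E]
  have hE : 0 ≤ E := (abs_nonneg _).trans (hcount ∅ (by simp))
  refine add_le_add ?_ (mul_le_mul_of_nonneg_left (card_powerset_card_le P (2 * h)) hE)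
  have e1 : ∑ T ∈ F, (-1 : ℝ) ^ T.card * (W * ∏ p ∈ T, g p) =
      W * ∑ T ∈ F, (-1 : ℝ) ^ T.card * ∏ p ∈ T, g p := by
    rw [mul_sum]; exact sum_congr rfl fun _ _ => by ring
  rw [e1]
  refine mul_le_mul_of_nonneg_left ?_ hW
  have e2 : ∏ p ∈ P, (1 - g p) = ∑ T ∈ P.powerset, (-1 : ℝ) ^ T.card * ∏ p ∈ T, g p := by
    simp_rw [sub_eq_add_neg, prod_one_add, prod_neg]
  have e3 := sum_filter_add_sum_filter_not P.powerset (fun T => T.card ≤ 2 * h)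
    (fun T => (-1 : ℝ) ^ T.card * ∏ p ∈ T, g p)
  have hpos : ∀ T ∈ P.powerset, 0 ≤ ∏ p ∈ T, g p := fun T hT =>
    prod_nonneg fun p hp => hg p (mem_powerset.1 hT hp)
  -- Rankin's trick for the truncated tail: card T > 2h gives 1 ≤ 4^(-h) 2^(card T), and the
  -- weighted sum over all T is the product of the factors 1 + 2g(p).
  have e4 : -∑ T ∈ P.powerset with ¬ T.card ≤ 2 * h, (-1 : ℝ) ^ T.card * ∏ p ∈ T, g p ≤
      (1 / 4) ^ h * Real.exp (2 * ∑ p ∈ P, g p) := by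
    calc -∑ T ∈ P.powerset with ¬ T.card ≤ 2 * h, (-1 : ℝ) ^ T.card * ∏ p ∈ T, g p
        ≤ ∑ T ∈ P.powerset with ¬ T.card ≤ 2 * h, (1 / 4) ^ h * ∏ p ∈ T, (2 * g p) := by
          rw [← sum_neg_distrib]
          refine sum_le_sum fun T hT => ?_
          rw [mem_filter] at hT
          have h0 := hpos T hT.1
          have h1 : -((-1 : ℝ) ^ T.card * ∏ p ∈ T, g p) ≤ ∏ p ∈ T, g p := by
            rcases neg_one_pow_eq_or ℝ T.card with h1 | h1 <;> rw [h1] <;> linarith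
          refine h1.trans ?_
          rw [prod_mul_distrib, prod_const, ← mul_assoc]
          refine le_mul_of_one_le_left h0 ?_
          have : (2 : ℝ) ^ (2 * h) ≤ 2 ^ T.card :=
            pow_le_pow_right₀ (by norm_num) (by omega)
          calc (1 : ℝ) = (1 / 4) ^ h * 2 ^ (2 * h) := by
                rw [pow_mul, ← mul_pow]; norm_num
            _ ≤ _ := mul_le_mul_of_nonneg_left this (by positivity)
      _ ≤ ∑ T ∈ P.powerset, (1 / 4) ^ h * ∏ p ∈ T, (2 * g p) := by
          refine sum_le_sum_of_subset_of_nonneg (filter_subset _ _) fun T hT _ => ?_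
          rw [prod_mul_distrib]
          have := hpos T hT
          positivity
      _ = (1 / 4) ^ h * ∏ p ∈ P, (1 + 2 * g p) := by rw [← mul_sum, prod_one_add]
      _ ≤ _ := by
          refine mul_le_mul_of_nonneg_left ?_ (by positivity)
          rw [mul_sum, Real.exp_sum]
          exact prod_le_prod (fun p hp => by have := hg p hp; positivity) fun p _ => by
            rw [add_comm]; exact Real.add_one_le_exp _
  linarith

/-! ### Chebyshev and Mertens type bounds -/

theorem pow_dvd_factorial_mul (p k : ℕ) (hp : 0 < p) : p ^ k ∣ (p * k).factorial := by
  induction k with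
  | zero => simp
  | succ k ih =>
    obtain ⟨m, hm⟩ : ∃ m, p * (k + 1) = m + 1 := ⟨p * (k + 1) - 1, by
      have : 0 < p * (k + 1) := by positivity
      omega⟩
    rw [hm, Nat.factorial_succ, ← hm, pow_succ, mul_comm (p ^ k)]
    refine mul_dvd_mul (dvd_mul_right _ _) (ih.trans (Nat.factorial_dvd_factorial ?_))
    have : p * (k + 1) = p * k + p := by ring
    omega

/-- The product of the p^⌊n/p⌋ divides n!, which is at most n^n. Take logarithms and use ⌊n/p⌋ ≥
n/(2p); this inequality is the source of the factor 2. -/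
theorem sum_log_div_prime_le (n : ℕ) :
    ∑ p ∈ (n + 1).primesBelow, Real.log p / p ≤ 2 * Real.log n := by
  rcases Nat.eq_zero_or_pos n with rfl | hn
  · simp [Nat.primesBelow, sum_filter]
  have hdvd : ∏ p ∈ (n + 1).primesBelow, p ^ (n / p) ∣ n.factorial := by
    refine Finset.prod_dvd_of_isRelPrime ?_ ?_
    · intro p hp q hq hpq
      have hp' := Nat.prime_of_mem_primesBelow hp
      have hq' := Nat.prime_of_mem_primesBelow hq
      exact Nat.coprime_iff_isRelPrime.1 (Nat.Coprime.pow _ _ ((Nat.coprime_primes hp' hq').2 hpq))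
    · intro p hp
      exact (pow_dvd_factorial_mul p _ (Nat.prime_of_mem_primesBelow hp).pos).trans
        (Nat.factorial_dvd_factorial (Nat.mul_div_le n p))
  have hle := (Nat.le_of_dvd (Nat.factorial_pos _) hdvd).trans (Nat.factorial_le_pow n)
  have hle' : ∑ p ∈ (n + 1).primesBelow, ((n / p : ℕ) : ℝ) * Real.log p ≤ n * Real.log n := by
    have : (∏ p ∈ (n + 1).primesBelow, (p : ℝ) ^ (n / p)) ≤ (n : ℝ) ^ n := by exact_mod_cast hle
    have h1 := Real.log_le_log (prod_pos fun p hp => by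
      have := (Nat.prime_of_mem_primesBelow hp).pos
      positivity) this
    rw [Real.log_pow, Real.log_prod (fun p hp => by
      have := (Nat.prime_of_mem_primesBelow hp).pos
      positivity)] at h1
    simpa [Real.log_pow] using h1
  have hn' : (0 : ℝ) < n := by exact_mod_cast hn
  have h2 : ∑ p ∈ (n + 1).primesBelow, (n : ℝ) / 2 * (Real.log p / p) ≤ n * Real.log n := by
    refine le_trans (sum_le_sum fun p hp => ?_) hle'
    have hpp := Nat.prime_of_mem_primesBelow hp
    have hpn : p ≤ n := Nat.lt_succ_iff.1 (Nat.lt_of_mem_primesBelow hp)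
    have hp0 : (0 : ℝ) < p := by exact_mod_cast hpp.pos
    have hlog : 0 ≤ Real.log p := Real.log_nonneg (by exact_mod_cast hpp.one_lt.le)
    have h3 : (n : ℝ) / p ≤ 2 * ((n / p : ℕ) : ℝ) := by
      rw [div_le_iff₀ hp0]
      have h4 := Nat.div_add_mod n p
      have h5 := Nat.mod_lt n hpp.pos
      have h6 : 1 ≤ n / p := (Nat.one_le_div_iff hpp.pos).2 hpn
      have : n ≤ 2 * (n / p) * p := by nlinarith
      exact_mod_cast this
    calc (n : ℝ) / 2 * (Real.log p / p) = (n / p) / 2 * Real.log p := by ring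
      _ ≤ _ := mul_le_mul_of_nonneg_right (by linarith) hlog
  rw [← mul_sum] at h2
  have := div_le_div_of_nonneg_right h2 hn'.le
  field_simp at this
  linarith

/-- For a prime p between n and n² one has 1/p ≤ (log p / p) / log n, and the previous bound at n²
is 4 log n. -/
theorem sum_inv_primesBelow_sq_le (n : ℕ) (hn : 2 ≤ n) :
    ∑ p ∈ Nat.primesBelow (n ^ 2 + 1), (1 : ℝ) / p ≤ ∑ p ∈ (n + 1).primesBelow, (1 : ℝ) / p + 4 := by
  have hlogn : 0 < Real.log n := Real.log_pos (by exact_mod_cast hn)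
  have hsub : (n + 1).primesBelow ⊆ Nat.primesBelow (n ^ 2 + 1) := by
    intro p hp
    rw [Nat.mem_primesBelow] at hp ⊢
    exact ⟨by nlinarith [hp.1], hp.2⟩
  rw [← sum_sdiff hsub, add_comm]
  refine add_le_add le_rfl ?_
  have h1 : ∑ p ∈ Nat.primesBelow (n ^ 2 + 1) \ (n + 1).primesBelow, (1 : ℝ) / p ≤
      ∑ p ∈ Nat.primesBelow (n ^ 2 + 1), (Real.log p / p) / Real.log n := by
    refine (sum_le_sum fun p hp => ?_).trans (sum_le_sum_of_subset_of_nonneg sdiff_subset ?_)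
    · rw [mem_sdiff, Nat.mem_primesBelow, Nat.mem_primesBelow] at hp
      have hnp : n ≤ p := by
        by_contra hcon
        exact hp.2 ⟨by omega, hp.1.2⟩
      have hp0 : (0 : ℝ) < p := by exact_mod_cast hp.1.2.pos
      rw [div_right_comm]
      refine div_le_div_of_nonneg_right ?_ hp0.le
      rw [one_le_div hlogn]
      exact Real.log_le_log (by positivity) (by exact_mod_cast hnp)
    · intro p hp _
      have := Real.log_nonneg (x := p)
        (by exact_mod_cast (Nat.prime_of_mem_primesBelow hp).one_lt.le)
      positivity
  refine h1.trans ?_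
  rw [← sum_div, div_le_iff₀ hlogn]
  have := sum_log_div_prime_le (n ^ 2)
  push_cast at this
  rw [Real.log_pow] at this
  push_cast at this
  linarith

/-- Squaring 2 repeatedly reaches 2^(2^j) after j steps, each costing 4, and about u / log 2 steps
pass n. The constant 8 is far from the true 1, but the depth of the sieve is chosen to compensate.
-/
theorem sum_inv_primesBelow_le (n : ℕ) (u : ℝ) (hu : 0 ≤ u) (hn : Real.log n ≤ Real.exp u) :
    ∑ p ∈ (n + 1).primesBelow, (1 : ℝ) / p ≤ 9 + 8 * u := by
  have hind : ∀ j : ℕ, ∑ p ∈ Nat.primesBelow (2 ^ 2 ^ j + 1), (1 : ℝ) / p ≤ 1 + 4 * j := by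
    intro j
    induction j with
    | zero =>
      have : Nat.primesBelow (2 ^ 2 ^ 0 + 1) = {2} := by decide
      rw [this]; norm_num
    | succ j ih =>
      have := sum_inv_primesBelow_sq_le (2 ^ 2 ^ j) (by
        calc 2 = 2 ^ 1 := rfl
          _ ≤ _ := Nat.pow_le_pow_right (by norm_num) Nat.one_le_two_pow)
      rw [← pow_mul, ← pow_succ] at this
      push_cast
      linarith
  set j := ⌈u / Real.log 2⌉₊ + 1 with hj
  have hl2 : 1 / 2 < Real.log 2 := by linarith [Real.log_two_gt_d9]
  have hj1 : u / Real.log 2 + 1 ≤ j := by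
    rw [hj]; push_cast; linarith [Nat.le_ceil (u / Real.log 2)]
  have hj2 : (j : ℝ) ≤ 2 * u + 2 := by
    have h1 := Nat.ceil_lt_add_one (a := u / Real.log 2) (by positivity)
    have h2 : u / Real.log 2 ≤ 2 * u := by
      rw [div_le_iff₀ (by linarith)]; nlinarith
    rw [hj]; push_cast; linarith
  have hn2 : n ≤ 2 ^ 2 ^ j := by
    rcases Nat.eq_zero_or_pos n with rfl | h0
    · positivity
    have : Real.log n ≤ Real.log ((2 : ℝ) ^ 2 ^ j) := by
      refine hn.trans ?_
      rw [Real.log_pow]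
      have h3 : u + Real.log 2 ≤ j * Real.log 2 := by
        have := mul_le_mul_of_nonneg_right hj1 (by linarith : 0 ≤ Real.log 2)
        rwa [add_mul, div_mul_cancel₀ _ (by linarith), one_mul] at this
      have h4 : Real.exp u * 2 ≤ (2 : ℝ) ^ j := by
        have := Real.exp_le_exp.2 h3
        rw [Real.exp_add, Real.exp_log (by norm_num), mul_comm (j : ℝ), Real.exp_mul,
          Real.exp_log (by norm_num)] at this
        exact_mod_cast this
      push_cast
      nlinarith [Real.exp_pos u]
    have := (Real.log_le_log_iff (by positivity) (by positivity)).1 this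
    exact_mod_cast this
  refine (sum_le_sum_of_subset_of_nonneg (t := Nat.primesBelow (2 ^ 2 ^ j + 1)) ?_
    fun _ _ _ => by positivity).trans ((hind j).trans (by linarith))
  intro p hp
  rw [Nat.mem_primesBelow] at hp ⊢
  exact ⟨by omega, hp.2⟩

/-- The Euler product of the factors (1 - 1/p)⁻¹ over p < n dominates the harmonic sum up to n - 1,
hence log n. -/
theorem prod_one_sub_inv_primesBelow_le (n : ℕ) (hn : 2 ≤ n) :
    ∏ p ∈ n.primesBelow, (1 - (1 : ℝ) / p) ≤ 1 / Real.log n := by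
  have hlogn : 0 < Real.log n := Real.log_pos (by exact_mod_cast hn)
  let f : ℕ →* ℝ :=
    { toFun := fun m => (m : ℝ)⁻¹, map_one' := by simp, map_mul' := fun a b => by
        push_cast; rw [mul_inv] }
  have hf := EulerProduct.summable_and_hasSum_smoothNumbers_prod_primesBelow_geometric (f := f)
    (fun {p} hp => by
      change ‖((p : ℝ))⁻¹‖ < 1
      rw [norm_inv, Real.norm_natCast]
      exact inv_lt_one_of_one_lt₀ (by exact_mod_cast hp.one_lt)) n
  have hH : Real.log n ≤ ∏ p ∈ n.primesBelow, (1 - f p)⁻¹ := by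
    obtain ⟨m, rfl⟩ : ∃ m, n = m + 1 := ⟨n - 1, by omega⟩
    refine (log_add_one_le_harmonic m).trans ?_
    rw [harmonic_eq_sum_Icc]
    push_cast
    have h1 : ∑ i ∈ Icc 1 m, (i : ℝ)⁻¹ = ∑ i : Icc 1 m, f (i : ℕ) :=
      (sum_coe_sort (Icc 1 m) (fun i : ℕ => (i : ℝ)⁻¹)).symm
    have hmem : ∀ i : Icc 1 m, (i : ℕ) ∈ (m + 1).smoothNumbers := fun i => by
      have := mem_Icc.1 i.2
      exact Nat.mem_smoothNumbers_of_lt (by omega) (by omega)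
    let e : Icc 1 m ↪ (m + 1).smoothNumbers :=
      ⟨fun i => ⟨i, hmem i⟩, fun i j hij => Subtype.ext
      (congrArg (fun b : (m + 1).smoothNumbers => (b : ℕ)) hij)⟩
    have h2 : ∑ i : Icc 1 m, f (i : ℕ) =
        ∑ b ∈ univ.map e, (fun b : (m + 1).smoothNumbers => f b) b := by
      rw [sum_map]; rfl
    rw [h1, h2]
    exact sum_le_hasSum _ (fun b _ => by change (0 : ℝ) ≤ ((b : ℕ) : ℝ)⁻¹; positivity) hf.2
  rw [prod_inv_distrib] at hH
  have hpos : 0 < ∏ p ∈ n.primesBelow, (1 - (1 : ℝ) / p) := prod_pos fun p hp => by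
    have h1 : (1 : ℝ) < p := by exact_mod_cast (Nat.prime_of_mem_primesBelow hp).one_lt
    rw [sub_pos, div_lt_one (by linarith)]; exact h1
  have e : ∏ p ∈ n.primesBelow, (1 - f p) = ∏ p ∈ n.primesBelow, (1 - (1 : ℝ) / p) :=
    prod_congr rfl fun p _ => by rw [one_div]; rfl
  rw [e] at hH
  rw [one_div]
  exact (le_inv_comm₀ hlogn hpos).1 hH

/-- Dropping the primes dividing k costs at most k/φ(k), since φ(k)/k is the product of 1 - 1/p over
all p ∣ k and each factor is at most 1. -/
theorem prod_one_sub_inv_primesBelow_coprime_le (n k : ℕ) (hn : 2 ≤ n) (hk : 0 < k) :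
    ∏ p ∈ n.primesBelow with ¬ p ∣ k, (1 - (1 : ℝ) / p) ≤
      (k : ℝ) / (k.totient * Real.log n) := by
  have hlogn : 0 < Real.log n := Real.log_pos (by exact_mod_cast hn)
  have hφ : (0 : ℝ) < k.totient := by exact_mod_cast Nat.totient_pos.2 hk
  have hk' : (0 : ℝ) < k := by exact_mod_cast hk
  have hle1 : ∀ p : ℕ, p.Prime → 0 < 1 - (1 : ℝ) / p ∧ 1 - (1 : ℝ) / p ≤ 1 := fun p hp => by
    have h1 : (1 : ℝ) < p := by exact_mod_cast hp.one_lt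
    refine ⟨?_, sub_le_self _ (by positivity)⟩
    rw [sub_pos, div_lt_one (by linarith)]; exact h1
  have htot : (k.totient : ℝ) / k = ∏ p ∈ k.primeFactors, (1 - (1 : ℝ) / p) := by
    have := congrArg (fun q : ℚ => (q : ℝ)) (Nat.totient_eq_mul_prod_factors k)
    push_cast at this
    rw [this, mul_div_cancel_left₀ _ hk'.ne']
    simp [one_div]
  have hsub : (k.totient : ℝ) / k ≤ ∏ p ∈ n.primesBelow with p ∣ k, (1 - (1 : ℝ) / p) := by
    rw [htot]
    refine prod_le_prod_of_subset_of_le_one ?_ ?_ ?_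
    · intro p hp
      rw [mem_filter, Nat.mem_primesBelow] at hp
      exact Nat.mem_primeFactors.2 ⟨hp.1.2, hp.2, hk.ne'⟩
    · intro p hp; exact (hle1 p (Nat.prime_of_mem_primeFactors hp)).1.le
    · intro p hp _; exact (hle1 p (Nat.prime_of_mem_primeFactors hp)).2
  have hall := prod_one_sub_inv_primesBelow_le n hn
  rw [← prod_filter_mul_prod_filter_not n.primesBelow (fun p => p ∣ k)] at hall
  have h0 : 0 ≤ ∏ p ∈ n.primesBelow with ¬ p ∣ k, (1 - (1 : ℝ) / p) := prod_nonneg fun p hp =>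
    (hle1 p (Nat.prime_of_mem_primesBelow (mem_filter.1 hp).1)).1.le
  have h1 := (mul_le_mul_of_nonneg_right hsub h0).trans hall
  rw [div_mul_eq_mul_div, div_le_div_iff₀ hk' hlogn] at h1
  rw [le_div_iff₀ (by positivity)]
  linarith

/-! ### Multiples in a residue class -/

/-- The number of multiples of `m` in a residue class modulo `k` in an interval. -/
theorem abs_card_multiples_in_class_sub_le (x : ℝ) (hx : 1 ≤ x) (k m : ℕ) (hk : 0 < k) (hm : 0 < m)
    (hkm : Nat.Coprime m k) (a : ℤ) :
    |((((Icc ⌈x⌉₊ ⌊2 * x⌋₊).filter (fun n : ℕ => (n : ℤ) ≡ a [ZMOD (k : ℤ)])).filter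
      (fun n => m ∣ n)).card : ℝ) - x / (k * m)| ≤ 2 := by
  -- The Chinese remainder theorem merges both conditions into one class modulo mk. Of the error 2,
  -- one unit comes from rounding the endpoints and one from the floors in the counting formula.
  set v : ℕ := (Nat.chineseRemainder hkm 0 (a % k).toNat : ℕ) with hv
  have hv1 := (Nat.chineseRemainder hkm 0 (a % k).toNat).2.1
  have hv2 := (Nat.chineseRemainder hkm 0 (a % k).toNat).2.2
  have hk' : (k : ℤ) ≠ 0 := by exact_mod_cast hk.ne'
  have hak : ((a % k).toNat : ℤ) ≡ a [ZMOD k] := by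
    rw [Int.toNat_of_nonneg (Int.emod_nonneg _ hk')]
    exact Int.mod_modEq a k
  have hset : ((Icc ⌈x⌉₊ ⌊2 * x⌋₊).filter (fun n : ℕ => (n : ℤ) ≡ a [ZMOD (k : ℤ)])).filter
      (fun n => m ∣ n) = (Ioc (⌈x⌉₊ - 1) ⌊2 * x⌋₊).filter (fun n => n ≡ v [MOD m * k]) := by
    have hx1 : 1 ≤ ⌈x⌉₊ := Nat.one_le_ceil_iff.2 (by linarith)
    ext n
    simp only [mem_filter, mem_Icc, mem_Ioc]
    have hiff : n ≡ v [MOD m * k] ↔ (n : ℤ) ≡ a [ZMOD (k : ℤ)] ∧ m ∣ n := by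
      rw [← Nat.modEq_and_modEq_iff_modEq_mul hkm]
      constructor
      · rintro ⟨h1, h2⟩
        refine ⟨?_, (Nat.modEq_zero_iff_dvd).1 (h1.trans hv1)⟩
        exact ((Int.natCast_modEq_iff).2 (h2.trans hv2)).trans hak
      · rintro ⟨h1, h2⟩
        refine ⟨((Nat.modEq_zero_iff_dvd).2 h2).trans hv1.symm, ?_⟩
        refine Nat.ModEq.trans ?_ hv2.symm
        exact (Int.natCast_modEq_iff).1 (h1.trans hak.symm)
    rw [hiff]
    constructor
    · rintro ⟨⟨⟨h1, h2⟩, h3⟩, h4⟩; exact ⟨⟨by omega, h2⟩, h3, h4⟩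
    · rintro ⟨⟨h1, h2⟩, h3, h4⟩; exact ⟨⟨⟨by omega, h2⟩, h3⟩, h4⟩
  rw [hset]
  have hr : 0 < m * k := Nat.mul_pos hm hk
  have hcard := Nat.Ioc_filter_modEq_card (⌈x⌉₊ - 1) ⌊2 * x⌋₊ hr v
  set c := ((Ioc (⌈x⌉₊ - 1) ⌊2 * x⌋₊).filter (fun n => n ≡ v [MOD m * k])).card with hc
  set s : ℚ := (((⌊2 * x⌋₊ : ℕ) : ℚ) - v) / ((m * k : ℕ) : ℚ) with hs
  set t : ℚ := (((⌈x⌉₊ - 1 : ℕ) : ℚ) - v) / ((m * k : ℕ) : ℚ) with ht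
  have hrR : (1 : ℝ) ≤ ((m * k : ℕ) : ℝ) := by exact_mod_cast hr
  have hst : (s : ℝ) - t = ((⌊2 * x⌋₊ : ℕ) - ((⌈x⌉₊ : ℕ) - 1 : ℝ)) / ((m * k : ℕ) : ℝ) := by
    rw [hs, ht]
    have : 1 ≤ ⌈x⌉₊ := Nat.one_le_ceil_iff.2 (by linarith)
    push_cast [Nat.cast_sub this]
    ring
  have f1 := Nat.floor_le (show (0 : ℝ) ≤ 2 * x by linarith)
  have f2 := Nat.lt_floor_add_one (2 * x)
  have f3 := Nat.le_ceil x
  have f4 := Nat.ceil_lt_add_one (show (0 : ℝ) ≤ x by linarith)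
  have hst1 : (s : ℝ) - t ≤ x / ((m * k : ℕ) : ℝ) + 1 := by
    rw [hst, div_add_one (by positivity)]
    exact div_le_div_of_nonneg_right (by linarith) (by positivity)
  have hst2 : x / ((m * k : ℕ) : ℝ) - 1 ≤ (s : ℝ) - t := by
    rw [hst, div_sub_one (by positivity)]
    exact div_le_div_of_nonneg_right (by linarith) (by positivity)
  have hs1 : ((⌊s⌋ : ℤ) : ℝ) ≤ s := by exact_mod_cast Int.floor_le s
  have hs2 : (s : ℝ) < ⌊s⌋ + 1 := by exact_mod_cast Int.lt_floor_add_one s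
  have ht1 : ((⌊t⌋ : ℤ) : ℝ) ≤ t := by exact_mod_cast Int.floor_le t
  have ht2 : (t : ℝ) < ⌊t⌋ + 1 := by exact_mod_cast Int.lt_floor_add_one t
  have hcR : (c : ℝ) = max (((⌊s⌋ : ℤ) : ℝ) - ⌊t⌋) 0 := by exact_mod_cast hcard
  have hcomm : (k : ℝ) * m = ((m * k : ℕ) : ℝ) := by push_cast; ring
  rw [hcomm, hcR, abs_le]
  have hx0 : 0 ≤ x / ((m * k : ℕ) : ℝ) := by positivity
  constructor
  · linarith [le_max_left (((⌊s⌋ : ℤ) : ℝ) - ⌊t⌋) 0]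
  · rcases max_choice (((⌊s⌋ : ℤ) : ℝ) - ⌊t⌋) 0 with h | h <;> rw [h] <;> linarith

/-! ### Smooth and rough parts of an integer -/

/-- The part of `n` composed of the primes `p < t`. -/
def smoothPart (t n : ℕ) : ℕ := ∏ p ∈ n.primeFactors with p < t, p ^ n.factorization p

/-- The part of `n` composed of the primes `p ≥ t`. -/
def roughPart (t n : ℕ) : ℕ := ∏ p ∈ n.primeFactors with ¬ p < t, p ^ n.factorization p

theorem smoothPart_mul_roughPart (t : ℕ) {n : ℕ} (hn : n ≠ 0) :
    smoothPart t n * roughPart t n = n := by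
  rw [smoothPart, roughPart, prod_filter_mul_prod_filter_not]
  exact Nat.prod_factorization_pow_eq_self hn

theorem prime_dvd_smoothPart {t n p : ℕ} (hp : p.Prime) (h : p ∣ smoothPart t n) : p < t := by
  obtain ⟨q, hq, hpq⟩ := (Prime.dvd_finsetProd_iff hp.prime _).1 h
  rw [mem_filter] at hq
  rw [(Nat.prime_dvd_prime_iff_eq hp (Nat.prime_of_mem_primeFactors hq.1)).1
    (hp.dvd_of_dvd_pow hpq)]
  exact hq.2

theorem prime_dvd_roughPart {t n p : ℕ} (hp : p.Prime) (h : p ∣ roughPart t n) : t ≤ p := by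
  obtain ⟨q, hq, hpq⟩ := (Prime.dvd_finsetProd_iff hp.prime _).1 h
  rw [mem_filter] at hq
  rw [(Nat.prime_dvd_prime_iff_eq hp (Nat.prime_of_mem_primeFactors hq.1)).1
    (hp.dvd_of_dvd_pow hpq)]
  exact not_lt.1 hq.2

theorem coprime_smoothPart_roughPart (t n : ℕ) : (smoothPart t n).Coprime (roughPart t n) :=
  Nat.coprime_of_dvd fun _ hp h1 h2 =>
    absurd (prime_dvd_smoothPart hp h1) (not_lt.2 (prime_dvd_roughPart hp h2))

theorem smoothPart_zero_left (n : ℕ) : smoothPart 0 n = 1 := by simp [smoothPart]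

theorem smoothPart_of_lt {t n : ℕ} (hn : n ≠ 0) (ht : n < t) : smoothPart t n = n := by
  rw [smoothPart, filter_true_of_mem]
  · exact Nat.prod_factorization_pow_eq_self hn
  · intro p hp
    exact (Nat.le_of_mem_primeFactors hp).trans_lt ht

theorem smoothPart_succ_of_mem {t n : ℕ} (h : t ∈ n.primeFactors) :
    smoothPart (t + 1) n = smoothPart t n * t ^ n.factorization t := by
  have : n.primeFactors.filter (fun p => p < t + 1) =
      insert t (n.primeFactors.filter (fun p => p < t)) := by
    ext p
    simp only [mem_filter, mem_insert]
    constructor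
    · rintro ⟨h1, h2⟩
      rcases Nat.lt_succ_iff_lt_or_eq.1 h2 with h3 | h3
      · exact Or.inr ⟨h1, h3⟩
      · exact Or.inl h3
    · rintro (rfl | ⟨h1, h2⟩)
      · exact ⟨h, Nat.lt_succ_self _⟩
      · exact ⟨h1, by omega⟩
  rw [smoothPart, this, prod_insert (by simp), mul_comm, smoothPart]

theorem smoothPart_succ_of_notMem {t n : ℕ} (h : t ∉ n.primeFactors) :
    smoothPart (t + 1) n = smoothPart t n := by
  rw [smoothPart, smoothPart]
  congr 1
  refine filter_congr fun p hp => ?_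
  have : p ≠ t := fun e => h (e ▸ hp)
  omega

/-- Let q be the prime at which the smooth part of n first exceeds M⁵, v its exponent in n, and b
the part below q, so b ≤ M⁵ < b q^v. If bq > M, then b and its cofactor serve. Otherwise b ≤ M and q
≤ M, so q^v > M⁴; the first power q^j > M is then at most M², and q^(2j) ≤ M⁴ < q^v shows that its
square divides n. -/
theorem exists_coprime_factorization_or_sq_dvd (n : ℕ) (hn : n ≠ 0) (M : ℝ) (hM : 1 ≤ M)
    (hMn : M ^ 5 < n) :
    (∃ m : ℕ, M < m ∧ (m : ℝ) ≤ M ^ 2 ∧ m ^ 2 ∣ n) ∨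
    ∃ q b d : ℕ, q.Prime ∧ q ∣ d ∧ n = b * d ∧ b.Coprime d ∧ (b : ℝ) ≤ M ^ 5 ∧ M < b * q ∧
      (∀ p : ℕ, p.Prime → p ∣ b → p < q) ∧ (∀ p : ℕ, p.Prime → p ∣ d → q ≤ p) := by
  classical
  have hex : ∃ t : ℕ, M ^ 5 < smoothPart (t + 1) n :=
    ⟨n, by rwa [smoothPart_of_lt hn (Nat.lt_succ_self n)]⟩
  set q := Nat.find hex with hq
  have hq1 : M ^ 5 < smoothPart (q + 1) n := Nat.find_spec hex
  have hq2 : (smoothPart q n : ℝ) ≤ M ^ 5 := by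
    rcases Nat.eq_zero_or_pos q with h0 | h0
    · rw [h0, smoothPart_zero_left]
      simpa using one_le_pow₀ hM
    · obtain ⟨t, ht⟩ : ∃ t, q = t + 1 := ⟨q - 1, by omega⟩
      have := Nat.find_min hex (m := t) (by omega)
      rw [ht]
      exact not_lt.1 this
  have hmem : q ∈ n.primeFactors := by
    by_contra h
    rw [smoothPart_succ_of_notMem h] at hq1
    linarith
  have hqp := Nat.prime_of_mem_primeFactors hmem
  rw [smoothPart_succ_of_mem hmem] at hq1
  set v := n.factorization q with hv
  set b := smoothPart q n with hb
  have hdvd : q ^ v ∣ n := Nat.ordProj_dvd n q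
  have hqR : (1 : ℝ) < q := by exact_mod_cast hqp.one_lt
  have hM0 : 0 < M := by linarith
  by_cases hbq : M < b * q
  · right
    refine ⟨q, b, roughPart q n, hqp, ?_, (smoothPart_mul_roughPart q hn).symm,
      coprime_smoothPart_roughPart q n, hq2, hbq, fun p hp h => prime_dvd_smoothPart hp h,
      fun p hp h => prime_dvd_roughPart hp h⟩
    have h1 : q ∣ b * roughPart q n := by
      rw [smoothPart_mul_roughPart q hn]; exact Nat.dvd_of_mem_primeFactors hmem
    rcases (Nat.Prime.dvd_mul hqp).1 h1 with h2 | h2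
    · exact absurd (prime_dvd_smoothPart hqp h2) (lt_irrefl _)
    · exact h2
  · left
    rw [not_lt] at hbq
    have hb1 : (1 : ℝ) ≤ b := by
      have : b ≠ 0 := fun h0 => by
        have := smoothPart_mul_roughPart q hn
        rw [← hb, h0, zero_mul] at this
        exact hn this.symm
      exact_mod_cast Nat.one_le_iff_ne_zero.2 this
    have hbM : (b : ℝ) ≤ M := by nlinarith
    have hqM : (q : ℝ) ≤ M := by nlinarith
    have hqv : M ^ 4 < (q : ℝ) ^ v := by
      push_cast at hq1
      have h1 : (b : ℝ) * q ^ v ≤ M * q ^ v := mul_le_mul_of_nonneg_right hbM (by positivity)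
      have h2 : M * M ^ 4 < M * (q : ℝ) ^ v := by
        calc M * M ^ 4 = M ^ 5 := by ring
          _ < _ := hq1.trans_le h1
      exact lt_of_mul_lt_mul_left h2 hM0.le
    have hex2 : ∃ j : ℕ, M < (q : ℝ) ^ j := ⟨v, lt_of_le_of_lt (by
      calc M = M ^ 1 := (pow_one M).symm
        _ ≤ M ^ 4 := pow_le_pow_right₀ hM (by norm_num)) hqv⟩
    set j := Nat.find hex2 with hj
    have hj1 : M < (q : ℝ) ^ j := Nat.find_spec hex2
    have hj0 : j ≠ 0 := fun h0 => by rw [h0, pow_zero] at hj1; linarith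
    obtain ⟨i, hi⟩ := Nat.exists_eq_succ_of_ne_zero hj0
    have hi1 : (q : ℝ) ^ i ≤ M := not_lt.1 (Nat.find_min hex2 (m := i) (by omega))
    have hjM : (q : ℝ) ^ j ≤ M ^ 2 := by
      rw [hi, pow_succ, sq]
      exact mul_le_mul hi1 hqM (by positivity) hM0.le
    refine ⟨q ^ j, by push_cast; exact hj1, by push_cast; exact hjM, ?_⟩
    rw [← pow_mul]
    refine (pow_dvd_pow q ?_).trans hdvd
    have h3 : (q : ℝ) ^ (j * 2) < (q : ℝ) ^ v := by
      refine lt_of_le_of_lt ?_ hqv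
      rw [pow_mul]
      calc ((q : ℝ) ^ j) ^ 2 ≤ (M ^ 2) ^ 2 := pow_le_pow_left₀ (by positivity) hjM 2
        _ = M ^ 4 := by ring
    exact ((pow_lt_pow_iff_right₀ hqR).1 h3).le

theorem le_pow_cardFactors {f : ArithmeticFunction ℝ} (hf : f.IsMultiplicative)
    (hnn : ∀ n, 0 ≤ f n) {B : ℝ} (hB : ∀ p l : ℕ, p.Prime → 1 ≤ l → f (p ^ l) ≤ B ^ l)
    {n : ℕ} (hn : n ≠ 0) : f n ≤ B ^ (ArithmeticFunction.cardFactors n) := by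
  rw [hf.multiplicative_factorization f hn, ArithmeticFunction.cardFactors_eq_sum_factorization,
    Finsupp.prod, Finsupp.sum, ← prod_pow_eq_pow_sum]
  refine prod_le_prod (fun p _ => hnn _) fun p hp => ?_
  rw [Nat.support_factorization] at hp
  exact hB p _ (Nat.prime_of_mem_primeFactors hp)
    ((Nat.prime_of_mem_primeFactors hp).factorization_pos_of_dvd hn (Nat.dvd_of_mem_primeFactors hp))

theorem pow_cardFactors_le {q n : ℕ} (hn : n ≠ 0) (h : ∀ p : ℕ, p.Prime → p ∣ n → q ≤ p) :
    q ^ ArithmeticFunction.cardFactors n ≤ n := by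
  rw [ArithmeticFunction.cardFactors_apply]
  conv_rhs => rw [← Nat.prod_primeFactorsList hn]
  refine List.pow_card_le_prod _ _ fun p hp => ?_
  exact h p (Nat.prime_of_mem_primeFactorsList hp) (Nat.dvd_of_mem_primeFactorsList hp)

/-- All prime factors are at least q, so q^Ω(n) ≤ n ≤ N bounds the number of factors, each of which
costs at most B. -/
theorem le_pow_log_of_rough {f : ArithmeticFunction ℝ} (hf : f.IsMultiplicative)
    (hnn : ∀ n, 0 ≤ f n) {B : ℝ} (hB1 : 1 ≤ B)
    (hB : ∀ p l : ℕ, p.Prime → 1 ≤ l → f (p ^ l) ≤ B ^ l)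
    {q n N : ℕ} (hn : n ≠ 0) (hnN : n ≤ N) (hq : 1 < q)
    (h : ∀ p : ℕ, p.Prime → p ∣ n → q ≤ p) : f n ≤ B ^ Nat.log q N := by
  refine (le_pow_cardFactors hf hnn hB hn).trans (pow_le_pow_right₀ hB1 ?_)
  exact (Nat.le_log_iff_pow_le hq (by omega)).2 ((pow_cardFactors_le hn h).trans hnN)

/-! ### Counting and sieving in a dyadic progression -/

/-- The natural numbers in `[x, 2x]` congruent to `a` modulo `k`. -/
noncomputable def dyadicClass (x : ℝ) (k : ℕ) (a : ℤ) : Finset ℕ :=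
  (Icc ⌈x⌉₊ ⌊2 * x⌋₊).filter (fun n : ℕ => (n : ℤ) ≡ a [ZMOD (k : ℤ)])

theorem coprime_of_mem_dyadicClass {x : ℝ} {k : ℕ} {a : ℤ} (ha : IsCoprime a (k : ℤ)) {n : ℕ}
    (hn : n ∈ dyadicClass x k a) : n.Coprime k := by
  have h := (mem_filter.1 hn).2
  rw [← Nat.isCoprime_iff_coprime]
  obtain ⟨c, hc⟩ := h.symm.dvd
  have : (n : ℤ) = a + k * c := by linarith
  rw [this]
  exact ha.add_mul_left_left c

/-- If m shares a factor with k there are no multiples, the class being coprime to k. Otherwise the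
error 2 is absorbed because x/(km) ≥ 1. -/
theorem card_multiples_dyadicClass_le {x : ℝ} (hx : 1 ≤ x) {k m : ℕ} (hk : 0 < k) (hm : 0 < m)
    {a : ℤ} (ha : IsCoprime a (k : ℤ)) (hkm : (k : ℝ) * m ≤ x) :
    (((dyadicClass x k a).filter (fun n => m ∣ n)).card : ℝ) ≤ 3 * x / (k * m) := by
  have hkm0 : (0 : ℝ) < k * m := by positivity
  by_cases hc : m.Coprime k
  · have h := (abs_le.1 (abs_card_multiples_in_class_sub_le x hx k m hk hm hc a)).2
    have h1 : 1 ≤ x / (k * m) := (one_le_div hkm0).2 hkm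
    rw [dyadicClass]
    calc _ ≤ x / (k * m) + 2 := by linarith
      _ ≤ 3 * (x / (k * m)) := by linarith
      _ = _ := by ring
  · rw [filter_false_of_mem]
    · simp only [card_empty, Nat.cast_zero]; positivity
    · intro n hn hmn
      exact hc ((coprime_of_mem_dyadicClass ha hn).coprime_dvd_left hmn)

/-- What is sifted is the cofactor n/b. Conditions of the form pb ∣ n for p in T combine into
divisibility by b∏p even when some p divides b, so the local densities are 1/p without exception. -/
theorem card_sifted_dyadicClass_le {x : ℝ} (hx : 1 ≤ x) {k b Y : ℕ} (hk : 0 < k) (hb : 0 < b)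
    (hkb : b.Coprime k) (a : ℤ) (hY : 2 ≤ Y) (h : ℕ) :
    (((dyadicClass x k a).filter
      (fun n => b ∣ n ∧ ∀ p ∈ Nat.primesBelow Y, ¬ p ∣ k → ¬ p * b ∣ n)).card : ℝ) ≤
      x / (k * b) * (k / (k.totient * Real.log Y) +
        (1 / 4) ^ h * Real.exp (2 * ∑ p ∈ Nat.primesBelow Y, (1 : ℝ) / p)) +
        2 * (Y : ℝ) ^ (2 * h) := by
  set P := (Nat.primesBelow Y).filter (fun p => ¬ p ∣ k) with hP
  set A := (dyadicClass x k a).filter (fun n => b ∣ n) with hA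
  have hPp : ∀ p ∈ P, p.Prime ∧ p.Coprime k := fun p hp => by
    rw [hP, mem_filter] at hp
    have := Nat.prime_of_mem_primesBelow hp.1
    exact ⟨this, (Nat.Prime.coprime_iff_not_dvd this).2 hp.2⟩
  have hcount : ∀ T ⊆ P, |((A.filter (fun n => ∀ p ∈ T, p * b ∣ n)).card : ℝ) -
      x / (k * b) * ∏ p ∈ T, (1 : ℝ) / (p : ℝ)| ≤ 2 := by
    intro T hT
    have hpair : ∀ p ∈ T, ∀ q ∈ T, p ≠ q → IsRelPrime p q := fun p hp q hq hpq =>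
      Nat.coprime_iff_isRelPrime.1
        ((Nat.coprime_primes (hPp p (hT hp)).1 (hPp q (hT hq)).1).2 hpq)
    have hm : 0 < b * ∏ p ∈ T, p :=
      Nat.mul_pos hb (prod_pos fun p hp => (hPp p (hT hp)).1.pos)
    have hcop : (b * ∏ p ∈ T, p).Coprime k :=
      Nat.Coprime.mul_left hkb (Nat.Coprime.prod_left fun p hp => (hPp p (hT hp)).2)
    have := abs_card_multiples_in_class_sub_le x hx k _ hk hm hcop a
    have e : A.filter (fun n => ∀ p ∈ T, p * b ∣ n) =
        (dyadicClass x k a).filter (fun n => b * ∏ p ∈ T, p ∣ n) := by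
      ext n
      simp only [hA, mem_filter, and_assoc]
      refine and_congr_right fun _ => ?_
      constructor
      · rintro ⟨⟨c, rfl⟩, h2⟩
        refine mul_dvd_mul_left b (Finset.prod_dvd_of_isRelPrime
          (fun p hp q hq hpq => hpair p hp q hq hpq) fun p hp => ?_)
        have := h2 p hp
        rw [mul_comm b c] at this
        exact Nat.dvd_of_mul_dvd_mul_right hb this
      · intro h2
        refine ⟨(dvd_mul_right _ _).trans h2, fun p hp => ?_⟩
        rw [mul_comm p b]
        exact (mul_dvd_mul_left b (dvd_prod_of_mem (fun p : ℕ => p) hp)).trans h2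
    rw [e, dyadicClass]
    convert this using 3
    push_cast
    rw [prod_div_distrib, prod_const_one, div_mul_div_comm, mul_one, mul_assoc]
  have hb' : (0 : ℝ) < b := by exact_mod_cast hb
  have hk' : (0 : ℝ) < k := by exact_mod_cast hk
  have key := brun_pure_sieve A P (fun p n => p * b ∣ n) (fun p => (1 : ℝ) / (p : ℝ))
    (fun p _ => by positivity) (x / (k * b)) 2 (by positivity) h hcount
  have eset : (dyadicClass x k a).filter
      (fun n => b ∣ n ∧ ∀ p ∈ Nat.primesBelow Y, ¬ p ∣ k → ¬ p * b ∣ n) =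
      A.filter (fun n => ∀ p ∈ P, ¬ p * b ∣ n) := by
    ext n
    simp only [hA, hP, mem_filter, and_assoc, and_imp]
  rw [eset]
  refine key.trans (add_le_add (mul_le_mul_of_nonneg_left (add_le_add ?_ ?_) (by positivity)) ?_)
  · exact prod_one_sub_inv_primesBelow_coprime_le Y k hY hk
  · refine mul_le_mul_of_nonneg_left (Real.exp_le_exp.2 (mul_le_mul_of_nonneg_left ?_ zero_le_two))
      (by positivity)
    exact sum_le_sum_of_subset_of_nonneg (filter_subset _ _) fun _ _ _ => by positivity
  · refine mul_le_mul_of_nonneg_left (pow_le_pow_left₀ (by positivity) ?_ _) zero_le_two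
    -- Erasing 0 leaves Y - 1 elements, which makes room for the +1 in the sieve's error term.
    have h1 : P ⊆ (range Y).erase 0 := by
      intro p hp
      rw [mem_erase]
      refine ⟨(hPp p hp).1.ne_zero, ?_⟩
      rw [hP, mem_filter, Nat.mem_primesBelow] at hp
      exact mem_range.2 hp.1.1
    have h2 := card_le_card h1
    rw [card_erase_of_mem (mem_range.2 (by omega)), card_range] at h2
    have : P.card + 1 ≤ Y := by omega
    exact_mod_cast this

/-! ### Rankin's method and Euler products -/

/-- Each Euler factor (1 - p^(-1/2))⁻¹ is at most 4, since 2^(-1/2) ≤ 3/4. -/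
theorem sum_rpow_neg_half_smooth_le (w : ℕ) (S : Finset ℕ) (hS0 : ∀ b ∈ S, b ≠ 0)
    (hS : ∀ b ∈ S, ∀ p : ℕ, p.Prime → p ∣ b → p < w) :
    ∑ b ∈ S, (b : ℝ) ^ (-(1 / 2) : ℝ) ≤ 4 ^ w := by
  let f : ℕ →* ℝ :=
    { toFun := fun m => (m : ℝ) ^ (-(1 / 2) : ℝ)
      map_one' := by simp
      map_mul' := fun a b => by
        push_cast; rw [Real.mul_rpow (by positivity) (by positivity)] }
  have hfp : ∀ p : ℕ, p.Prime → f p ≤ 3 / 4 := fun p hp => by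
    change (p : ℝ) ^ (-(1 / 2) : ℝ) ≤ 3 / 4
    have h2 : (2 : ℝ) ≤ p := by exact_mod_cast hp.two_le
    refine (Real.rpow_le_rpow_of_nonpos (by norm_num) h2 (by norm_num)).trans ?_
    rw [Real.rpow_neg (by norm_num), ← Real.sqrt_eq_rpow]
    rw [inv_le_comm₀ (by positivity) (by norm_num)]
    refine Real.le_sqrt_of_sq_le (by norm_num)
  have hf0 : ∀ m : ℕ, 0 ≤ f m := fun m => by
    change 0 ≤ (m : ℝ) ^ (-(1 / 2) : ℝ)
    positivity
  have hf := EulerProduct.summable_and_hasSum_smoothNumbers_prod_primesBelow_geometric (f := f)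
    (fun {p} hp => by
      rw [Real.norm_of_nonneg (hf0 p)]
      linarith [hfp p hp]) w
  have hmem : ∀ b : S, (b : ℕ) ∈ w.smoothNumbers := fun b => by
    rw [Nat.mem_smoothNumbers]
    exact ⟨hS0 b b.2, fun p hp => hS b b.2 p (Nat.prime_of_mem_primeFactorsList hp)
      (Nat.dvd_of_mem_primeFactorsList hp)⟩
  let e : S ↪ w.smoothNumbers :=
    ⟨fun i => ⟨i, hmem i⟩, fun i j hij => Subtype.ext
      (congrArg (fun b : w.smoothNumbers => (b : ℕ)) hij)⟩
  have h1 : ∑ b ∈ S, (b : ℝ) ^ (-(1 / 2) : ℝ) =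
      ∑ b ∈ univ.map e, (fun b : w.smoothNumbers => f b) b := by
    rw [sum_map]
    exact (sum_coe_sort S (fun i : ℕ => (i : ℝ) ^ (-(1 / 2) : ℝ))).symm
  rw [h1]
  refine (sum_le_hasSum _ (fun (b : w.smoothNumbers) _ => hf0 (b : ℕ)) hf.2).trans ?_
  calc ∏ p ∈ w.primesBelow, (1 - f p)⁻¹ ≤ ∏ p ∈ w.primesBelow, (4 : ℝ) :=
        prod_le_prod (fun p hp => by
          have := hfp p (Nat.prime_of_mem_primesBelow hp)
          exact inv_nonneg.2 (by linarith)) fun p hp => by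
          have := hfp p (Nat.prime_of_mem_primesBelow hp)
          rw [inv_le_comm₀ (by linarith) (by norm_num)]
          linarith
    _ = 4 ^ w.primesBelow.card := by rw [prod_const]
    _ ≤ 4 ^ w := pow_le_pow_right₀ (by norm_num) (by
      refine (card_le_card (filter_subset _ _)).trans ?_
      rw [card_range])

theorem natCast_pow_rpow (p l : ℕ) (s : ℝ) : (((p ^ l : ℕ) : ℝ)) ^ s = ((p : ℝ) ^ s) ^ l := by
  push_cast
  rw [← Real.rpow_natCast, ← Real.rpow_natCast, ← Real.rpow_mul (by positivity),
    ← Real.rpow_mul (by positivity), mul_comm]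

section Rankin

variable {f : ArithmeticFunction ℝ} {B K δ : ℝ}

/-- When p ≥ 4B² the ratio t = B p^(δ-1) is at most 1/2, so the prime powers p^l with l ≥ 2
contribute at most 2t² ≤ 2B² p^(-3/2) to the Euler factor. The bound with exponent 1/8 serves only
for convergence. -/
theorem sum_rankin_rough_le (hf : f.IsMultiplicative) (hnn : ∀ n, 0 ≤ f n) (hB1 : 1 ≤ B)
    (hB : ∀ p l : ℕ, p.Prime → 1 ≤ l → f (p ^ l) ≤ B ^ l)
    (hK : ∀ n : ℕ, 1 ≤ n → f n ≤ K * (n : ℝ) ^ (1 / 8 : ℝ)) (hδ : δ ≤ 1 / 8)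
    (P : Finset ℕ) (hP : ∀ p ∈ P, p.Prime ∧ 4 * B ^ 2 ≤ p) (S : Finset ℕ)
    (hS0 : ∀ b ∈ S, b ≠ 0) (hS : ∀ b ∈ S, ∀ p : ℕ, p.Prime → p ∣ b → p ∈ P) :
    ∑ b ∈ S, f b * (b : ℝ) ^ (δ - 1) ≤
      Real.exp (∑ p ∈ P, (f p * (p : ℝ) ^ (δ - 1) + 2 * B ^ 2 * (p : ℝ) ^ (-(3 / 2) : ℝ))) := by
  set g : ℕ → ℝ := fun b => f b * (b : ℝ) ^ (δ - 1) with hg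
  have hg0 : ∀ n, 0 ≤ g n := fun n => mul_nonneg (hnn n) (by positivity)
  have hg1 : g 1 = 1 := by simp [hg, hf.map_one]
  have hgmul : ∀ {m n : ℕ}, Nat.Coprime m n → g (m * n) = g m * g n := fun {m n} hmn => by
    simp only [hg]
    rw [hf.map_mul_of_coprime hmn]
    push_cast
    rw [Real.mul_rpow (by positivity) (by positivity)]
    ring
  have hsum : ∀ {p : ℕ}, p.Prime → Summable (fun n : ℕ => ‖g (p ^ n)‖) := fun {p} hp => by
    have hp2 : (2 : ℝ) ≤ p := by exact_mod_cast hp.two_le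
    have hlt : (p : ℝ) ^ (-(3 / 4) : ℝ) < 1 :=
      Real.rpow_lt_one_of_one_lt_of_neg (by linarith) (by norm_num)
    refine Summable.of_nonneg_of_le (fun _ => norm_nonneg _) (fun n => ?_)
      ((summable_geometric_of_lt_one (by positivity) hlt).mul_left K)
    rw [Real.norm_of_nonneg (hg0 _)]
    have hpn : 1 ≤ p ^ n := Nat.one_le_pow _ _ hp.pos
    have hpn' : (1 : ℝ) ≤ ((p ^ n : ℕ) : ℝ) := by exact_mod_cast hpn
    have hK0 : 0 ≤ K := by
      have := (hnn 1).trans (hK 1 le_rfl)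
      simpa using this
    calc g (p ^ n) ≤ K * ((p ^ n : ℕ) : ℝ) ^ (1 / 8 : ℝ) * ((p ^ n : ℕ) : ℝ) ^ (δ - 1) :=
          mul_le_mul_of_nonneg_right (hK _ hpn) (by positivity)
      _ = K * ((p ^ n : ℕ) : ℝ) ^ (1 / 8 + (δ - 1)) := by
          rw [mul_assoc, ← Real.rpow_add (by linarith)]
      _ ≤ K * ((p ^ n : ℕ) : ℝ) ^ (-(3 / 4) : ℝ) :=
          mul_le_mul_of_nonneg_left (Real.rpow_le_rpow_of_exponent_le hpn' (by linarith)) hK0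
      _ = _ := by rw [natCast_pow_rpow]
  have hE := EulerProduct.summable_and_hasSum_factoredNumbers_prod_filter_prime_tsum
    hg1 hgmul hsum P
  have hmem : ∀ b : S, (b : ℕ) ∈ Nat.factoredNumbers P := fun b => by
    rw [Nat.mem_factoredNumbers]
    exact ⟨hS0 b b.2, fun p hp => hS b b.2 p (Nat.prime_of_mem_primeFactorsList hp)
      (Nat.dvd_of_mem_primeFactorsList hp)⟩
  let e : S ↪ Nat.factoredNumbers P :=
    ⟨fun i => ⟨i, hmem i⟩, fun i j hij => Subtype.ext
      (congrArg (fun b : Nat.factoredNumbers P => (b : ℕ)) hij)⟩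
  have h1 : ∑ b ∈ S, g b = ∑ b ∈ univ.map e, (fun b : Nat.factoredNumbers P => g b) b := by
    rw [sum_map]
    exact (sum_coe_sort S g).symm
  change ∑ b ∈ S, g b ≤ _
  rw [h1]
  refine (sum_le_hasSum _ (fun (b : Nat.factoredNumbers P) _ => hg0 (b : ℕ)) hE.2).trans ?_
  rw [filter_true_of_mem fun p hp => (hP p hp).1, Real.exp_sum]
  refine prod_le_prod (fun p _ => tsum_nonneg fun _ => hg0 _) fun p hp => ?_
  obtain ⟨hpp, hpB⟩ := hP p hp
  have hp1 : (1 : ℝ) < p := by exact_mod_cast hpp.one_lt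
  have hp0 : (0 : ℝ) < p := by linarith
  have hsump : Summable (fun n : ℕ => g (p ^ n)) := (hsum hpp).of_norm
  set t := B * (p : ℝ) ^ (δ - 1) with ht
  have ht0 : 0 ≤ t := by positivity
  have ht1 : t ≤ 1 / 2 := by
    have h2 : 2 * B ≤ (p : ℝ) ^ (1 / 2 : ℝ) := by
      rw [← Real.sqrt_eq_rpow]
      exact Real.le_sqrt_of_sq_le (by nlinarith)
    have h3 : (p : ℝ) ^ (δ - 1) ≤ (p : ℝ) ^ (-(1 / 2) : ℝ) :=
      Real.rpow_le_rpow_of_exponent_le hp1.le (by linarith)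
    calc t ≤ ((p : ℝ) ^ (1 / 2 : ℝ) / 2) * (p : ℝ) ^ (-(1 / 2) : ℝ) :=
          mul_le_mul (by linarith) h3 (by positivity) (by positivity)
      _ = 1 / 2 * ((p : ℝ) ^ (1 / 2 : ℝ) * (p : ℝ) ^ (-(1 / 2) : ℝ)) := by ring
      _ = 1 / 2 := by rw [← Real.rpow_add hp0]; norm_num
  have hterm : ∀ l : ℕ, g (p ^ (l + 2)) ≤ t ^ 2 * t ^ l := fun l => by
    simp only [hg]
    rw [natCast_pow_rpow, ← pow_add, ht, mul_pow, add_comm 2 l]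
    exact mul_le_mul_of_nonneg_right (hB p (l + 2) hpp (by omega)) (by positivity)
  have hgeo : Summable (fun l : ℕ => t ^ 2 * t ^ l) :=
    (summable_geometric_of_lt_one ht0 (by linarith)).mul_left _
  have htail : ∑' l : ℕ, g (p ^ (l + 2)) ≤ 2 * t ^ 2 := by
    refine (Summable.tsum_le_tsum hterm ((summable_nat_add_iff 2).2 hsump) hgeo).trans ?_
    rw [tsum_mul_left, tsum_geometric_of_lt_one ht0 (by linarith), mul_comm 2]
    refine mul_le_mul_of_nonneg_left ?_ (by positivity)
    rw [inv_le_comm₀ (by linarith) (by norm_num)]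
    linarith
  have ht2 : t ^ 2 ≤ B ^ 2 * (p : ℝ) ^ (-(3 / 2) : ℝ) := by
    rw [ht, mul_pow]
    refine mul_le_mul_of_nonneg_left ?_ (by positivity)
    rw [← Real.rpow_natCast, ← Real.rpow_mul hp0.le]
    exact Real.rpow_le_rpow_of_exponent_le hp1.le (by push_cast; linarith)
  rw [← hsump.sum_add_tsum_nat_add 2, sum_range_succ, sum_range_one, pow_zero, pow_one, hg1]
  refine le_trans ?_ (Real.add_one_le_exp _)
  have : g p = f p * (p : ℝ) ^ (δ - 1) := rfl
  linarith

/-- At small primes f(p^l) ≤ B^l is useless, as the series in B p^(δ-1) may diverge. The w-smooth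
part is therefore estimated by f(n) ≤ K n^(1/8), which leaves the exponent 1/8 + δ - 1 ≤ -1/2, and
costs K 4^w. -/
theorem sum_rankin_le (hf : f.IsMultiplicative) (hnn : ∀ n, 0 ≤ f n) (hB1 : 1 ≤ B)
    (hB : ∀ p l : ℕ, p.Prime → 1 ≤ l → f (p ^ l) ≤ B ^ l)
    (hK : ∀ n : ℕ, 1 ≤ n → f n ≤ K * (n : ℝ) ^ (1 / 8 : ℝ)) (hδ : δ ≤ 1 / 8)
    (P : Finset ℕ) (hP : ∀ p ∈ P, p.Prime) (w : ℕ) (hw : 4 * B ^ 2 ≤ w) (S : Finset ℕ)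
    (hS0 : ∀ b ∈ S, b ≠ 0) (hS : ∀ b ∈ S, ∀ p : ℕ, p.Prime → p ∣ b → p ∈ P) :
    ∑ b ∈ S, f b * (b : ℝ) ^ (δ - 1) ≤ K * 4 ^ w *
      Real.exp (∑ p ∈ P, (f p * (p : ℝ) ^ (δ - 1) + 2 * B ^ 2 * (p : ℝ) ^ (-(3 / 2) : ℝ))) := by
  have hK0 : 0 ≤ K := by
    have := (hnn 1).trans (hK 1 le_rfl)
    simpa using this
  set g : ℕ → ℝ := fun b => f b * (b : ℝ) ^ (δ - 1) with hg
  have hg0 : ∀ n, 0 ≤ g n := fun n => mul_nonneg (hnn n) (by positivity)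
  have hsplit : ∀ b ∈ S, g b = g (smoothPart w b) * g (roughPart w b) := fun b hb => by
    simp only [hg]
    conv_lhs => rw [← smoothPart_mul_roughPart w (hS0 b hb)]
    rw [hf.map_mul_of_coprime (coprime_smoothPart_roughPart w b)]
    push_cast
    rw [Real.mul_rpow (by positivity) (by positivity)]
    ring
  have hne : ∀ b ∈ S, smoothPart w b ≠ 0 ∧ roughPart w b ≠ 0 := fun b hb =>
    mul_ne_zero_iff.1 (by rw [smoothPart_mul_roughPart w (hS0 b hb)]; exact hS0 b hb)
  have h1 : ∑ b ∈ S, g b ≤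
      (∑ s ∈ S.image (smoothPart w), g s) * ∑ r ∈ S.image (roughPart w), g r := by
    rw [sum_mul_sum, ← sum_product', sum_congr rfl hsplit]
    rw [← sum_image (s := S) (g := fun b => (smoothPart w b, roughPart w b))
      (f := fun z : ℕ × ℕ => g z.1 * g z.2)]
    · refine sum_le_sum_of_subset_of_nonneg ?_ fun z _ _ => mul_nonneg (hg0 _) (hg0 _)
      intro z hz
      obtain ⟨b, hb, rfl⟩ := mem_image.1 hz
      exact mem_product.2 ⟨mem_image_of_mem _ hb, mem_image_of_mem _ hb⟩
    · intro b hb c hc hbc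
      simp only [Prod.mk.injEq] at hbc
      rw [← smoothPart_mul_roughPart w (hS0 b hb), ← smoothPart_mul_roughPart w (hS0 c hc),
        hbc.1, hbc.2]
  have h2 : ∑ s ∈ S.image (smoothPart w), g s ≤ K * 4 ^ w := by
    have h3 := sum_rpow_neg_half_smooth_le w (S.image (smoothPart w))
      (fun s hs => by
        obtain ⟨b, hb, rfl⟩ := mem_image.1 hs
        exact (hne b hb).1)
      (fun s hs p hp hps => by
        obtain ⟨b, hb, rfl⟩ := mem_image.1 hs
        exact prime_dvd_smoothPart hp hps)
    refine le_trans ?_ (mul_le_mul_of_nonneg_left h3 hK0)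
    rw [mul_sum]
    refine sum_le_sum fun s hs => ?_
    obtain ⟨b, hb, rfl⟩ := mem_image.1 hs
    have hs1 := Nat.one_le_iff_ne_zero.2 (hne b hb).1
    have hs1' : (1 : ℝ) ≤ smoothPart w b := by exact_mod_cast hs1
    calc g (smoothPart w b)
        ≤ K * (smoothPart w b : ℝ) ^ (1 / 8 : ℝ) * (smoothPart w b : ℝ) ^ (δ - 1) :=
          mul_le_mul_of_nonneg_right (hK _ hs1) (by positivity)
      _ = K * (smoothPart w b : ℝ) ^ (1 / 8 + (δ - 1)) := by
          rw [mul_assoc, ← Real.rpow_add (by linarith)]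
      _ ≤ _ := mul_le_mul_of_nonneg_left
          (Real.rpow_le_rpow_of_exponent_le hs1' (by linarith)) hK0
  have h4 : ∑ r ∈ S.image (roughPart w), g r ≤
      Real.exp (∑ p ∈ P, (f p * (p : ℝ) ^ (δ - 1) + 2 * B ^ 2 * (p : ℝ) ^ (-(3 / 2) : ℝ))) := by
    refine (sum_rankin_rough_le hf hnn hB1 hB hK hδ (P.filter (fun p => w ≤ p)) ?_ _ ?_ ?_).trans
      (Real.exp_le_exp.2 (sum_le_sum_of_subset_of_nonneg (filter_subset _ _) fun p _ _ => ?_))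
    · intro p hp
      rw [mem_filter] at hp
      exact ⟨hP p hp.1, hw.trans (by exact_mod_cast hp.2)⟩
    · intro r hr
      obtain ⟨b, hb, rfl⟩ := mem_image.1 hr
      exact (hne b hb).2
    · intro r hr p hp hpr
      obtain ⟨b, hb, rfl⟩ := mem_image.1 hr
      refine mem_filter.2 ⟨hS b hb p hp (hpr.trans ?_), prime_dvd_roughPart hp hpr⟩
      exact Dvd.intro_left _ (smoothPart_mul_roughPart w (hS0 b hb))
    · have := hnn p
      positivity
  exact h1.trans (mul_le_mul h2 h4 (sum_nonneg fun _ _ => hg0 _) (by positivity))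

/-- The weight p^δ is removed by p^δ - 1 ≤ δ (log p) p^δ ≤ δ (log p) U. Summed against B/p this
costs at most 2BUδ log N ≤ 2BU log U. -/
theorem sum_rankin_le_exp (hf : f.IsMultiplicative) (hnn : ∀ n, 0 ≤ f n) (hB1 : 1 ≤ B)
    (hB : ∀ p l : ℕ, p.Prime → 1 ≤ l → f (p ^ l) ≤ B ^ l)
    (hK : ∀ n : ℕ, 1 ≤ n → f n ≤ K * (n : ℝ) ^ (1 / 8 : ℝ)) (hδ0 : 0 ≤ δ) (hδ : δ ≤ 1 / 8)
    (P : Finset ℕ) (N : ℕ) (hP : ∀ p ∈ P, p.Prime ∧ p ≤ N) (U : ℝ) (hU : 1 ≤ U)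
    (hδN : δ * Real.log N ≤ Real.log U) (w : ℕ) (hw : 4 * B ^ 2 ≤ w) (S : Finset ℕ)
    (hS0 : ∀ b ∈ S, b ≠ 0) (hS : ∀ b ∈ S, ∀ p : ℕ, p.Prime → p ∣ b → p ∈ P) :
    ∑ b ∈ S, f b * (b : ℝ) ^ (δ - 1) ≤ K * 4 ^ w *
      Real.exp (∑ p ∈ P, f p / p + 2 * B * U * Real.log U +
        2 * B ^ 2 * ∑' n : ℕ, (n : ℝ) ^ (-(3 / 2) : ℝ)) := by
  have hK0 : 0 ≤ K := by
    have := (hnn 1).trans (hK 1 le_rfl)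
    simpa using this
  refine (sum_rankin_le hf hnn hB1 hB hK hδ P (fun p hp => (hP p hp).1) w hw S hS0 hS).trans
    (mul_le_mul_of_nonneg_left (Real.exp_le_exp.2 ?_) (by positivity))
  rw [sum_add_distrib, ← mul_sum]
  have h1 : ∑ p ∈ P, (p : ℝ) ^ (-(3 / 2) : ℝ) ≤ ∑' n : ℕ, (n : ℝ) ^ (-(3 / 2) : ℝ) :=
    Summable.sum_le_tsum P (fun n _ => by positivity) (Real.summable_nat_rpow.2 (by norm_num))
  have h2 : ∀ p ∈ P, f p * (p : ℝ) ^ (δ - 1) ≤ f p / p + B * δ * U * (Real.log p / p) := by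
    intro p hp
    obtain ⟨hpp, hpN⟩ := hP p hp
    have hp1 : (1 : ℝ) < p := by exact_mod_cast hpp.one_lt
    have hp0 : (0 : ℝ) < p := by linarith
    have hlog : 0 ≤ Real.log p := Real.log_nonneg hp1.le
    have hfp : f p ≤ B := by simpa using hB p 1 hpp le_rfl
    have hpU : (p : ℝ) ^ δ ≤ U := by
      rw [Real.rpow_def_of_pos hp0, ← Real.exp_log (by linarith : 0 < U)]
      refine Real.exp_le_exp.2 (le_trans ?_ hδN)
      rw [mul_comm]
      exact mul_le_mul_of_nonneg_left (Real.log_le_log hp0 (by exact_mod_cast hpN)) hδ0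
    have h3 : (p : ℝ) ^ δ - 1 ≤ δ * Real.log p * U := by
      have h4 : (p : ℝ) ^ δ - 1 ≤ δ * Real.log p * (p : ℝ) ^ δ := by
        have h5 := Real.add_one_le_exp (-(Real.log p * δ))
        have h6 : (p : ℝ) ^ δ * Real.exp (-(Real.log p * δ)) = 1 := by
          rw [Real.rpow_def_of_pos hp0, ← Real.exp_add, add_neg_cancel, Real.exp_zero]
        have h7 := mul_le_mul_of_nonneg_left h5 (by positivity : 0 ≤ (p : ℝ) ^ δ)
        rw [h6] at h7
        linarith
      exact h4.trans (mul_le_mul_of_nonneg_left hpU (by positivity))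
    have h8 : f p * ((p : ℝ) ^ δ - 1) ≤ B * (δ * Real.log p * U) := by
      have h9 : 0 ≤ (p : ℝ) ^ δ - 1 := sub_nonneg.2 (Real.one_le_rpow hp1.le hδ0)
      exact mul_le_mul hfp h3 h9 (by linarith)
    rw [Real.rpow_sub_one hp0.ne']
    have h10 : f p * ((p : ℝ) ^ δ / p) = f p / p + f p * ((p : ℝ) ^ δ - 1) / p := by ring
    rw [h10]
    have := div_le_div_of_nonneg_right h8 hp0.le
    calc f p / p + f p * ((p : ℝ) ^ δ - 1) / p ≤ f p / p + B * (δ * Real.log p * U) / p := by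
          linarith
      _ = _ := by ring
  have h3 : ∑ p ∈ P, f p * (p : ℝ) ^ (δ - 1) ≤ ∑ p ∈ P, f p / p + 2 * B * U * Real.log U := by
    refine (sum_le_sum h2).trans ?_
    rw [sum_add_distrib, ← mul_sum]
    have h4 : ∑ p ∈ P, Real.log p / (p : ℝ) ≤ 2 * Real.log N := by
      refine le_trans (sum_le_sum_of_subset_of_nonneg (t := Nat.primesBelow (N + 1)) ?_ ?_)
        (sum_log_div_prime_le N)
      · intro p hp
        exact Nat.mem_primesBelow.2 ⟨Nat.lt_succ_of_le (hP p hp).2, (hP p hp).1⟩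
      · intro p hp _
        have := Real.log_natCast_nonneg p
        positivity
    have h5 : B * δ * U * ∑ p ∈ P, Real.log p / (p : ℝ) ≤ B * δ * U * (2 * Real.log N) :=
      mul_le_mul_of_nonneg_left h4 (by positivity)
    have h6 : 2 * B * U * (δ * Real.log N) ≤ 2 * B * U * Real.log U :=
      mul_le_mul_of_nonneg_left hδN (by positivity)
    linarith
  have h4 := mul_le_mul_of_nonneg_left h1 (by positivity : (0 : ℝ) ≤ 2 * B ^ 2)
  linarith

end Rankin

/-! ### Decomposition of the sum over the progression -/

theorem sum_filter_exists_le {γ ι : Type*} (A : Finset γ) (C : Finset ι) (R : ι → γ → Prop)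
    [∀ c, DecidablePred (R c)] [DecidablePred fun n => ∃ c ∈ C, R c n]
    (V : ι → ℝ) (f : γ → ℝ) (hV : ∀ c ∈ C, 0 ≤ V c)
    (h : ∀ n ∈ A, ∀ c ∈ C, R c n → f n ≤ V c) :
    ∑ n ∈ A with (∃ c ∈ C, R c n), f n ≤ ∑ c ∈ C, V c * ((A.filter (R c)).card : ℝ) := by
  have e : ∀ c ∈ C, V c * ((A.filter (R c)).card : ℝ) = ∑ n ∈ A, if R c n then V c else 0 :=
    fun c _ => by rw [← sum_filter, sum_const, nsmul_eq_mul, mul_comm]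
  rw [sum_congr rfl e, sum_comm, sum_filter]
  have hnn : ∀ n ∈ A, ∀ c ∈ C, 0 ≤ (if R c n then V c else 0) := fun n _ c hc => by
    split_ifs
    · exact hV c hc
    · exact le_rfl
  refine sum_le_sum fun n hn => ?_
  split_ifs with hex
  · obtain ⟨c, hc, hR⟩ := hex
    refine (h n hn c hc hR).trans ?_
    have := single_le_sum (hnn n hn) hc
    rwa [if_pos hR] at this
  · exact sum_nonneg (hnn n hn)

section ClassSum

variable {x : ℝ} {k : ℕ} {a : ℤ} {f : ArithmeticFunction ℝ} {B F M U : ℝ}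

open Classical in
theorem sum_dyadicClass_large_square_le (hx : 1 ≤ x) (hk : 0 < k) (ha : IsCoprime a (k : ℤ))
    (hF0 : 0 ≤ F) (hF : ∀ n ∈ dyadicClass x k a, f n ≤ F) (hM : 1 ≤ M) (hMk : k * M ^ 5 < x) :
    ∑ n ∈ dyadicClass x k a with (∃ m : ℕ, M < m ∧ (m : ℝ) ≤ M ^ 2 ∧ m ^ 2 ∣ n), f n ≤
      F * (3 * x / k) * (2 / M) := by
  have hk' : (0 : ℝ) < k := by exact_mod_cast hk
  have e : ∀ n, (∃ m : ℕ, M < m ∧ (m : ℝ) ≤ M ^ 2 ∧ m ^ 2 ∣ n) ↔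
      ∃ m ∈ Ioo ⌊M⌋₊ (⌊M ^ 2⌋₊ + 1), m ^ 2 ∣ n := fun n => by
    refine exists_congr fun m => ?_
    rw [mem_Ioo, Nat.floor_lt (by linarith), Nat.lt_succ_iff, Nat.le_floor_iff (by positivity),
      and_assoc]
  rw [filter_congr fun n _ => e n]
  refine (sum_filter_exists_le _ _ (fun m n => m ^ 2 ∣ n) (fun _ => F) _ (fun _ _ => hF0)
    fun n hn _ _ _ => hF n hn).trans ?_
  rw [← mul_sum, mul_assoc]
  refine mul_le_mul_of_nonneg_left ?_ hF0
  calc ∑ m ∈ Ioo ⌊M⌋₊ (⌊M ^ 2⌋₊ + 1), (((dyadicClass x k a).filter (fun n => m ^ 2 ∣ n)).card : ℝ)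
      ≤ ∑ m ∈ Ioo ⌊M⌋₊ (⌊M ^ 2⌋₊ + 1), 3 * x / k * ((m : ℝ) ^ 2)⁻¹ := by
        refine sum_le_sum fun m hm => ?_
        rw [mem_Ioo, Nat.lt_succ_iff, Nat.le_floor_iff (by positivity)] at hm
        have hm0 : 0 < m := by omega
        have := card_multiples_dyadicClass_le hx hk (m := m ^ 2) (by positivity) ha (by
          refine le_trans (mul_le_mul_of_nonneg_left ?_ hk'.le) hMk.le
          push_cast
          calc (m : ℝ) ^ 2 ≤ (M ^ 2) ^ 2 := pow_le_pow_left₀ (by positivity) hm.2 2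
            _ = M ^ 4 := by ring
            _ ≤ M ^ 5 := pow_le_pow_right₀ hM (by norm_num))
        push_cast at this
        refine this.trans (le_of_eq ?_)
        field_simp
    _ = 3 * x / k * ∑ m ∈ Ioo ⌊M⌋₊ (⌊M ^ 2⌋₊ + 1), ((m : ℝ) ^ 2)⁻¹ := by rw [mul_sum]
    _ ≤ 3 * x / k * (2 / M) := by
        refine mul_le_mul_of_nonneg_left ((sum_Ioo_inv_sq_le _ _).trans ?_) (by positivity)
        exact div_le_div_of_nonneg_left (by norm_num) (by linarith) (Nat.lt_floor_add_one M).le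

open Classical in
-- Rankin's trick with exponent 1/2: b > M/w gives 1/b ≤ (w/M)^(1/2) b^(-1/2), and the sum of
-- b^(-1/2) over w-smooth b is at most 4^w.
theorem sum_dyadicClass_smooth_divisor_le (hx : 1 ≤ x) (hk : 0 < k) (ha : IsCoprime a (k : ℤ))
    (hF0 : 0 ≤ F) (hF : ∀ n ∈ dyadicClass x k a, f n ≤ F) (hM : 1 ≤ M) (hMk : k * M ^ 5 < x)
    (w : ℕ) (hw : 1 ≤ w) :
    ∑ n ∈ dyadicClass x k a with (∃ b : ℕ, M < b * w ∧ (b : ℝ) ≤ M ^ 5 ∧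
      (∀ p : ℕ, p.Prime → p ∣ b → p < w) ∧ b ∣ n), f n ≤
      F * (3 * x / k) * ((w / M) ^ (1 / 2 : ℝ) * 4 ^ w) := by
  have hk' : (0 : ℝ) < k := by exact_mod_cast hk
  have hw' : (0 : ℝ) < w := by exact_mod_cast hw
  have hM0 : 0 < M := by linarith
  set C := (range (⌊M ^ 5⌋₊ + 1)).filter (fun b : ℕ => M < b * w ∧
    ∀ p : ℕ, p.Prime → p ∣ b → p < w) with hC
  have e : ∀ n, (∃ b : ℕ, M < b * w ∧ (b : ℝ) ≤ M ^ 5 ∧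
      (∀ p : ℕ, p.Prime → p ∣ b → p < w) ∧ b ∣ n) ↔ ∃ b ∈ C, b ∣ n := fun n => by
    refine exists_congr fun b => ?_
    rw [hC, mem_filter, mem_range, Nat.lt_succ_iff, Nat.le_floor_iff (by positivity)]
    tauto
  have hCm : ∀ b ∈ C, (b : ℝ) ≤ M ^ 5 ∧ M < b * w ∧ (∀ p : ℕ, p.Prime → p ∣ b → p < w) := by
    intro b hb
    rwa [hC, mem_filter, mem_range, Nat.lt_succ_iff, Nat.le_floor_iff (by positivity)] at hb
  have hC0 : ∀ b ∈ C, b ≠ 0 := fun b hb h0 => by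
    have := (hCm b hb).2.1
    rw [h0] at this
    simp at this
    linarith
  rw [filter_congr fun n _ => e n]
  refine (sum_filter_exists_le _ C (fun b n => b ∣ n) (fun _ => F) _ (fun _ _ => hF0)
    fun n hn _ _ _ => hF n hn).trans ?_
  rw [← mul_sum, mul_assoc]
  refine mul_le_mul_of_nonneg_left ?_ hF0
  calc ∑ b ∈ C, (((dyadicClass x k a).filter (fun n => b ∣ n)).card : ℝ)
      ≤ ∑ b ∈ C, 3 * x / k * ((w / M) ^ (1 / 2 : ℝ) * (b : ℝ) ^ (-(1 / 2) : ℝ)) := by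
        refine sum_le_sum fun b hb => ?_
        obtain ⟨h1, h2, h3⟩ := hCm b hb
        have hb0 : 0 < b := Nat.pos_of_ne_zero (hC0 b hb)
        have hb0' : (0 : ℝ) < b := by exact_mod_cast hb0
        refine (card_multiples_dyadicClass_le hx hk hb0 ha
          ((mul_le_mul_of_nonneg_left h1 hk'.le).trans hMk.le)).trans ?_
        have h4 : (b : ℝ)⁻¹ ≤ (w / M) ^ (1 / 2 : ℝ) * (b : ℝ) ^ (-(1 / 2) : ℝ) := by
          have h5 : (b : ℝ)⁻¹ ≤ w / M := by
            rw [inv_le_comm₀ hb0' (by positivity), inv_div, div_le_iff₀ hw']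
            exact h2.le
          calc (b : ℝ)⁻¹ = ((b : ℝ)⁻¹) ^ (1 / 2 : ℝ) * (b : ℝ) ^ (-(1 / 2) : ℝ) := by
                rw [Real.inv_rpow hb0'.le, ← Real.rpow_neg hb0'.le, ← Real.rpow_add hb0',
                  ← Real.rpow_neg_one]
                norm_num
            _ ≤ _ := mul_le_mul_of_nonneg_right
              (Real.rpow_le_rpow (by positivity) h5 (by norm_num)) (by positivity)
        calc 3 * x / (k * b) = 3 * x / k * (b : ℝ)⁻¹ := by field_simp
          _ ≤ _ := mul_le_mul_of_nonneg_left h4 (by positivity)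
    _ = 3 * x / k * ((w / M) ^ (1 / 2 : ℝ) * ∑ b ∈ C, (b : ℝ) ^ (-(1 / 2) : ℝ)) := by
        rw [mul_sum, mul_sum]
    _ ≤ _ := by
        refine mul_le_mul_of_nonneg_left (mul_le_mul_of_nonneg_left ?_ (by positivity))
          (by positivity)
        exact sum_rpow_neg_half_smooth_le w C hC0 fun b hb => (hCm b hb).2.2

open Classical in
-- The heart of the argument. The lower bound bq > M is traded for the saving M^(-λr), which offsets
-- f(d) ≤ B^r; the price is the factor U and the weight b^δ.
theorem sum_dyadicClass_rough_cofactor_le (hx : 1 ≤ x) (hk : 0 < k) (ha : IsCoprime a (k : ℤ))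
    (hf : f.IsMultiplicative) (hnn : ∀ n, 0 ≤ f n) (hB1 : 1 ≤ B)
    (hB : ∀ p l : ℕ, p.Prime → 1 ≤ l → f (p ^ l) ≤ B ^ l) (hM : 1 ≤ M)
    (hMk : k * M ^ 5 < x) (hU : 1 ≤ U) {w : ℕ} (hw : 2 ≤ w) (hUw : U ^ 8 ≤ w) {lam : ℝ}
    (hlam : lam * Real.log (2 * x) = Real.log U) {r h Y : ℕ} (hY : 2 ≤ Y)
    (hYh : Y ^ (h + 1) ≤ ⌊2 * x⌋₊) {G T : ℝ} (hG0 : 0 ≤ G) (hT0 : 0 ≤ T)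
    (hT : ∀ b : ℕ, 0 < b → b.Coprime k → (b : ℝ) ≤ M ^ 5 → (((dyadicClass x k a).filter
      (fun n => b ∣ n ∧ ∀ p ∈ Nat.primesBelow Y, ¬ p ∣ k → ¬ p * b ∣ n)).card : ℝ) ≤ T / b)
    (hG : (r : ℝ) * lam ≤ 1 / 8 → ∀ S : Finset ℕ, (∀ b ∈ S, b ≠ 0 ∧ (b : ℝ) ≤ M ^ 5) →
      (∀ b ∈ S, ∀ p : ℕ, p.Prime → p ∣ b → p ^ r ≤ ⌊2 * x⌋₊ ∧ ¬ p ∣ k) →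
      ∑ b ∈ S, f b * (b : ℝ) ^ (r * lam - 1) ≤ G) :
    ∑ n ∈ dyadicClass x k a with (∃ q b d : ℕ, w ≤ q ∧ Nat.log q ⌊2 * x⌋₊ = r ∧ n = b * d ∧
      b.Coprime d ∧ (b : ℝ) ≤ M ^ 5 ∧ M < b * q ∧ (∀ p : ℕ, p.Prime → p ∣ b → p < q) ∧
      (∀ p : ℕ, p.Prime → p ∣ d → q ≤ p)), f n ≤
    (B * M ^ (-lam)) ^ r * U * G * (if r ≤ h then T else 3 * x / k) := by
  have hk' : (0 : ℝ) < k := by exact_mod_cast hk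
  have hM0 : 0 < M := by linarith
  have hU0 : 0 < U := by linarith
  have hl2 : 0 < Real.log (2 * x) := Real.log_pos (by linarith)
  have hlam0 : 0 ≤ lam := by
    by_contra hneg
    have := Real.log_nonneg hU
    nlinarith [not_le.1 hneg]
  set N := ⌊2 * x⌋₊ with hN
  have hN0 : N ≠ 0 := (Nat.floor_pos.2 (by linarith)).ne'
  have hNx : (N : ℝ) ≤ 2 * x := Nat.floor_le (by linarith)
  set δ := (r : ℝ) * lam with hδ
  have hδ0 : 0 ≤ δ := by positivity
  set T' : ℝ := if r ≤ h then T else 3 * x / k with hT'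
  have hT'0 : 0 ≤ T' := by
    rw [hT']; split_ifs
    · exact hT0
    · positivity
  -- The variable q is eliminated here: p < q is weakened to p^r ≤ N, so the admissible b depend on
  -- r alone.
  set C := (range (⌊M ^ 5⌋₊ + 1)).filter (fun b : ℕ => b ≠ 0 ∧ b.Coprime k ∧
    ∀ p : ℕ, p.Prime → p ∣ b → p ^ r ≤ N ∧ ¬ p ∣ k) with hC
  have hCm : ∀ b, b ∈ C ↔ (b : ℝ) ≤ M ^ 5 ∧ b ≠ 0 ∧ b.Coprime k ∧
      ∀ p : ℕ, p.Prime → p ∣ b → p ^ r ≤ N ∧ ¬ p ∣ k := by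
    intro b
    rw [hC, mem_filter, mem_range, Nat.lt_succ_iff, Nat.le_floor_iff (by positivity)]
  -- a member of the class forces `δ ≤ 1 / 8`
  by_cases hδ8 : δ ≤ 1 / 8
  swap
  · rw [filter_false_of_mem]
    · rw [sum_empty]; positivity
    · rintro n hn ⟨q, b, d, hwq, hr, -⟩
      apply hδ8
      have hq : (1 : ℝ) < q := by exact_mod_cast (show 1 < q by omega)
      have h1 : q ^ r ≤ N := hr ▸ Nat.pow_log_le_self q hN0
      have h2 : (q : ℝ) ^ r ≤ 2 * x := le_trans (by exact_mod_cast h1) hNx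
      have h3 : (r : ℝ) * Real.log q ≤ Real.log (2 * x) := by
        rw [← Real.log_pow]; exact Real.log_le_log (by positivity) h2
      -- From U⁸ ≤ w ≤ q and q^r ≤ 2x it follows that 8r log U ≤ log 2x, that is δ ≤ 1/8.
      have h4 : 8 * Real.log U ≤ Real.log q := by
        have := Real.log_le_log (by positivity) (hUw.trans (show (w : ℝ) ≤ q by exact_mod_cast hwq))
        rw [Real.log_pow] at this
        exact_mod_cast this
      have h5 : δ * (8 * Real.log (2 * x)) ≤ Real.log (2 * x) := by
        calc δ * (8 * Real.log (2 * x)) = r * (8 * Real.log U) := by rw [hδ, ← hlam]; ring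
          _ ≤ r * Real.log q := mul_le_mul_of_nonneg_left h4 (by positivity)
          _ ≤ _ := h3
      nlinarith
  set R : ℕ → ℕ → Prop := fun b n => b ∣ n ∧
    (r ≤ h → ∀ p ∈ Nat.primesBelow Y, ¬ p ∣ k → ¬ p * b ∣ n) with hR
  set V : ℕ → ℝ := fun b => (B * M ^ (-lam)) ^ r * U * (f b * (b : ℝ) ^ δ) with hV
  have hV0 : ∀ b, 0 ≤ V b := fun b => by have := hnn b; positivity
  have hpt : ∀ n ∈ dyadicClass x k a, (∃ q b d : ℕ, w ≤ q ∧ Nat.log q N = r ∧ n = b * d ∧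
      b.Coprime d ∧ (b : ℝ) ≤ M ^ 5 ∧ M < b * q ∧ (∀ p : ℕ, p.Prime → p ∣ b → p < q) ∧
      (∀ p : ℕ, p.Prime → p ∣ d → q ≤ p)) → ∃ b ∈ C, R b n ∧ f n ≤ V b := by
    rintro n hn ⟨q, b, d, hwq, hr, rfl, hbd, hbM, hMbq, hbq, hdq⟩
    have hcop := coprime_of_mem_dyadicClass ha hn
    have hbk : b.Coprime k := hcop.coprime_dvd_left (dvd_mul_right _ _)
    have hnpos : b * d ≠ 0 := by
      have h1 := (mem_Icc.1 (mem_filter.1 hn).1).1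
      have h2 : 1 ≤ ⌈x⌉₊ := Nat.one_le_ceil_iff.2 (by linarith)
      omega
    have hb0 : b ≠ 0 := left_ne_zero_of_mul hnpos
    have hd0 : d ≠ 0 := right_ne_zero_of_mul hnpos
    have hnN : b * d ≤ N := (mem_Icc.1 (mem_filter.1 hn).1).2
    have hq1 : 1 < q := by omega
    have hqr : q ^ r ≤ N := hr ▸ Nat.pow_log_le_self q hN0
    refine ⟨b, (hCm b).2 ⟨hbM, hb0, hbk, fun p hp hpb => ⟨?_, ?_⟩⟩, ⟨dvd_mul_right _ _, ?_⟩, ?_⟩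
    · exact (Nat.pow_le_pow_left (hbq p hp hpb).le r).trans hqr
    · intro hpk
      exact hp.one_lt.ne' (Nat.dvd_one.1 (hbk ▸ Nat.dvd_gcd hpb hpk))
    -- A prime p < Y dividing d would force q < Y, whence N < q^(r+1) ≤ Y^(h+1) ≤ N.
    · intro hrh p hp _ hdvd
      rw [mul_comm p b] at hdvd
      have hpd := Nat.dvd_of_mul_dvd_mul_left (Nat.pos_of_ne_zero hb0) hdvd
      have hqp := hdq p (Nat.prime_of_mem_primesBelow hp) hpd
      have hpY := Nat.lt_of_mem_primesBelow hp
      have h1 : N < q ^ (r + 1) := hr ▸ Nat.lt_pow_succ_log_self hq1 N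
      have h2 : q ^ (r + 1) ≤ Y ^ (h + 1) :=
        (Nat.pow_le_pow_left (by omega) _).trans (Nat.pow_le_pow_right (by omega) (by omega))
      omega
    · rw [hf.map_mul_of_coprime hbd]
      have hfd : f d ≤ B ^ r := by
        have := le_pow_log_of_rough hf hnn hB1 hB hd0
          ((Nat.le_mul_of_pos_left d (Nat.pos_of_ne_zero hb0)).trans hnN) hq1 hdq
        rwa [hr] at this
      have hq0 : (0 : ℝ) < q := by positivity
      have hqU : (q : ℝ) ^ δ ≤ U := by
        rw [Real.rpow_def_of_pos hq0, ← Real.exp_log hU0]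
        refine Real.exp_le_exp.2 ?_
        have h2 : (q : ℝ) ^ r ≤ 2 * x := le_trans (by exact_mod_cast hqr) hNx
        have h3 : (r : ℝ) * Real.log q ≤ Real.log (2 * x) := by
          rw [← Real.log_pow]; exact Real.log_le_log (by positivity) h2
        calc Real.log q * δ = lam * (r * Real.log q) := by rw [hδ]; ring
          _ ≤ lam * Real.log (2 * x) := mul_le_mul_of_nonneg_left h3 hlam0
          _ = _ := hlam
      have hb0' : (0 : ℝ) < b := by exact_mod_cast Nat.pos_of_ne_zero hb0
      -- This is 1 ≤ (bq/M)^δ combined with q^δ ≤ U.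
      have hone : 1 ≤ (b : ℝ) ^ δ * U * (M ^ (-lam)) ^ r := by
        have h1 : 1 ≤ ((b : ℝ) * q / M) ^ δ :=
          Real.one_le_rpow ((one_le_div hM0).2 hMbq.le) hδ0
        have h2 : (M ^ (-lam)) ^ r = (M ^ δ)⁻¹ := by
          rw [← Real.rpow_natCast, ← Real.rpow_mul hM0.le, ← Real.rpow_neg hM0.le]
          congr 1; rw [hδ]; ring
        rw [Real.div_rpow (by positivity) hM0.le, Real.mul_rpow hb0'.le hq0.le] at h1
        rw [h2, ← div_eq_mul_inv]
        refine h1.trans (div_le_div_of_nonneg_right ?_ (by positivity))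
        exact mul_le_mul_of_nonneg_left hqU (by positivity)
      calc f b * f d ≤ f b * B ^ r := mul_le_mul_of_nonneg_left hfd (hnn b)
        _ ≤ f b * B ^ r * ((b : ℝ) ^ δ * U * (M ^ (-lam)) ^ r) :=
          le_mul_of_one_le_right (mul_nonneg (hnn b) (by positivity)) hone
        _ = V b := by rw [hV]; simp only; rw [mul_pow]; ring
  have hcard : ∀ b ∈ C, (((dyadicClass x k a).filter (R b)).card : ℝ) ≤ T' / b := by
    intro b hb
    obtain ⟨hbM, hb0, hbk, -⟩ := (hCm b).1 hb
    rw [hT']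
    split_ifs with hrh
    · refine le_trans (le_of_eq ?_) (hT b (Nat.pos_of_ne_zero hb0) hbk hbM)
      congr 2
      refine filter_congr fun n _ => ?_
      simp only [hR, hrh, true_imp_iff]
    · have e : (dyadicClass x k a).filter (R b) = (dyadicClass x k a).filter (fun n => b ∣ n) :=
        filter_congr fun n _ => by simp only [hR, hrh, false_imp_iff, and_true]
      rw [e, div_div]
      exact card_multiples_dyadicClass_le hx hk (Nat.pos_of_ne_zero hb0) ha
        ((mul_le_mul_of_nonneg_left hbM hk'.le).trans hMk.le)
  calc _ ≤ ∑ n ∈ dyadicClass x k a with (∃ b ∈ C, R b n ∧ f n ≤ V b), f n := by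
        refine sum_le_sum_of_subset_of_nonneg ?_ fun n _ _ => hnn n
        intro n hn
        rw [mem_filter] at hn ⊢
        exact ⟨hn.1, hpt n hn.1 hn.2⟩
    _ ≤ ∑ b ∈ C, V b * (((dyadicClass x k a).filter (fun n => R b n ∧ f n ≤ V b)).card : ℝ) :=
        sum_filter_exists_le _ C (fun b n => R b n ∧ f n ≤ V b) V _ (fun b _ => hV0 b)
          fun n _ b _ h => h.2
    _ ≤ ∑ b ∈ C, V b * (T' / b) := by
        refine sum_le_sum fun b hb => mul_le_mul_of_nonneg_left ?_ (hV0 b)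
        refine le_trans ?_ (hcard b hb)
        have hsub : (dyadicClass x k a).filter (fun n => R b n ∧ f n ≤ V b) ⊆
            (dyadicClass x k a).filter (R b) := fun n hn =>
          mem_filter.2 ⟨(mem_filter.1 hn).1, (mem_filter.1 hn).2.1⟩
        exact_mod_cast card_le_card hsub
    _ = (B * M ^ (-lam)) ^ r * U * T' * ∑ b ∈ C, f b * (b : ℝ) ^ (δ - 1) := by
        rw [mul_sum]
        refine sum_congr rfl fun b hb => ?_
        have hb0' : (b : ℝ) ≠ 0 := by exact_mod_cast ((hCm b).1 hb).2.1
        rw [Real.rpow_sub_one hb0', hV]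
        ring
    _ ≤ (B * M ^ (-lam)) ^ r * U * T' * G :=
        mul_le_mul_of_nonneg_left (hG hδ8 C (fun b hb => ⟨((hCm b).1 hb).2.1, ((hCm b).1 hb).1⟩)
          fun b hb => ((hCm b).1 hb).2.2.2) (by positivity)
    _ = _ := by ring

theorem sum_range_pow_mul_ite_le {ρ T T' : ℝ} (hρ0 : 0 ≤ ρ) (hρ : ρ ≤ 1 / 2) (hT0 : 0 ≤ T)
    (hT'0 : 0 ≤ T') (h n : ℕ) :
    ∑ r ∈ range n, ρ ^ r * (if r ≤ h then T else T') ≤ 2 * T + 2 * ρ ^ h * T' := by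
  have hgeo : ∑ r ∈ range n, ρ ^ r ≤ 2 := by
    have h1 := (summable_geometric_of_lt_one hρ0 (by linarith)).sum_le_tsum (range n)
      fun _ _ => by positivity
    rw [tsum_geometric_of_lt_one hρ0 (by linarith)] at h1
    refine h1.trans ?_
    rw [inv_le_comm₀ (by linarith) (by norm_num)]
    linarith
  have hgeo' : ∑ r ∈ range n, (if r ≤ h then 0 else ρ ^ r) ≤ 2 * ρ ^ h := by
    calc ∑ r ∈ range n, (if r ≤ h then 0 else ρ ^ r)
        ≤ ∑ r ∈ range (h + n), (if r ≤ h then 0 else ρ ^ r) := by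
          refine sum_le_sum_of_subset_of_nonneg (by intro m; simp only [mem_range]; omega) ?_
          intro r _ _
          split_ifs <;> positivity
      _ ≤ ∑ r ∈ range n, ρ ^ h * ρ ^ r := by
          rw [sum_range_add]
          have : ∑ r ∈ range h, (if r ≤ h then 0 else ρ ^ r) = 0 :=
            sum_eq_zero fun r hr => if_pos (mem_range.1 hr).le
          rw [this, zero_add]
          refine sum_le_sum fun r _ => ?_
          rw [← pow_add]
          split_ifs
          · positivity
          · exact le_rfl
      _ ≤ 2 * ρ ^ h := by
          rw [← mul_sum, mul_comm 2]
          exact mul_le_mul_of_nonneg_left hgeo (by positivity)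
  calc ∑ r ∈ range n, ρ ^ r * (if r ≤ h then T else T')
      ≤ ∑ r ∈ range n, (ρ ^ r * T + (if r ≤ h then 0 else ρ ^ r) * T') := by
        refine sum_le_sum fun r _ => ?_
        split_ifs
        · rw [zero_mul, add_zero]
        · exact le_add_of_nonneg_left (by positivity)
    _ = (∑ r ∈ range n, ρ ^ r) * T + (∑ r ∈ range n, (if r ≤ h then 0 else ρ ^ r)) * T' := by
        rw [sum_add_distrib, sum_mul, sum_mul]
    _ ≤ _ := add_le_add (mul_le_mul_of_nonneg_right hgeo hT0)
        (mul_le_mul_of_nonneg_right hgeo' hT'0)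

/-- Every n has a large square divisor, or is cut at some q < w, in which case b is w-smooth with bw
> M, or is cut at some q ≥ w. The last kind is summed over r as a geometric series, with the sieve
bound T up to h and the trivial count beyond. -/
theorem sum_dyadicClass_le (hx : 1 ≤ x) (hk : 0 < k) (ha : IsCoprime a (k : ℤ))
    (hf : f.IsMultiplicative) (hnn : ∀ n, 0 ≤ f n) (hB1 : 1 ≤ B)
    (hB : ∀ p l : ℕ, p.Prime → 1 ≤ l → f (p ^ l) ≤ B ^ l)
    (hF0 : 0 ≤ F) (hF : ∀ n ∈ dyadicClass x k a, f n ≤ F) (hM : 1 ≤ M)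
    (hMk : k * M ^ 5 < x) (hU : 1 ≤ U) {w : ℕ} (hw : 2 ≤ w) (hUw : U ^ 8 ≤ w) {lam : ℝ}
    (hlam : lam * Real.log (2 * x) = Real.log U) {h Y : ℕ} (hY : 2 ≤ Y)
    (hYh : Y ^ (h + 1) ≤ ⌊2 * x⌋₊) {G T ρ : ℝ} (hG0 : 0 ≤ G) (hT0 : 0 ≤ T)
    (hρ : B * M ^ (-lam) ≤ ρ) (hρ2 : ρ ≤ 1 / 2)
    (hT : ∀ b : ℕ, 0 < b → b.Coprime k → (b : ℝ) ≤ M ^ 5 → (((dyadicClass x k a).filter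
      (fun n => b ∣ n ∧ ∀ p ∈ Nat.primesBelow Y, ¬ p ∣ k → ¬ p * b ∣ n)).card : ℝ) ≤ T / b)
    (hG : ∀ r : ℕ, (r : ℝ) * lam ≤ 1 / 8 → ∀ S : Finset ℕ, (∀ b ∈ S, b ≠ 0 ∧ (b : ℝ) ≤ M ^ 5) →
      (∀ b ∈ S, ∀ p : ℕ, p.Prime → p ∣ b → p ^ r ≤ ⌊2 * x⌋₊ ∧ ¬ p ∣ k) →
      ∑ b ∈ S, f b * (b : ℝ) ^ (r * lam - 1) ≤ G) :
    ∑ n ∈ dyadicClass x k a, f n ≤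
      F * (3 * x / k) * (2 / M + (w / M) ^ (1 / 2 : ℝ) * 4 ^ w) +
        U * G * (2 * T + 2 * ρ ^ h * (3 * x / k)) := by
  classical
  have hk' : (1 : ℝ) ≤ k := by exact_mod_cast hk
  set N := ⌊2 * x⌋₊ with hN
  set A := dyadicClass x k a with hA
  have h2 := sum_dyadicClass_large_square_le (f := f) hx hk ha hF0 hF hM hMk
  have h3 := sum_dyadicClass_smooth_divisor_le (f := f) hx hk ha hF0 hF hM hMk w (by omega)
  have h4 : ∀ r ∈ range (N + 1), _ := fun r _ =>
    sum_dyadicClass_rough_cofactor_le (r := r) hx hk ha hf hnn hB1 hB hM hMk hU hw hUw hlam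
      hY hYh hG0 hT0 hT (hG r)
  have h5 := sum_le_sum h4
  have h6 : ∑ r ∈ range (N + 1),
      (B * M ^ (-lam)) ^ r * U * G * (if r ≤ h then T else 3 * x / k) ≤
      U * G * (2 * T + 2 * ρ ^ h * (3 * x / k)) := by
    have hρ0 : 0 ≤ B * M ^ (-lam) := by positivity
    calc _ = U * G * ∑ r ∈ range (N + 1),
          (B * M ^ (-lam)) ^ r * (if r ≤ h then T else 3 * x / k) := by
          rw [mul_sum]; exact sum_congr rfl fun _ _ => by ring
      _ ≤ U * G * (2 * T + 2 * (B * M ^ (-lam)) ^ h * (3 * x / k)) :=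
          mul_le_mul_of_nonneg_left (sum_range_pow_mul_ite_le hρ0 (hρ.trans hρ2) hT0
            (by positivity) h _) (by positivity)
      _ ≤ _ := by
          have := pow_le_pow_left₀ hρ0 hρ h
          gcongr
  refine le_trans ?_ ((add_le_add (add_le_add h2 h3) (h5.trans h6)).trans (le_of_eq (by ring)))
  simp_rw [sum_filter]
  rw [sum_comm (s := range (N + 1)), ← sum_add_distrib, ← sum_add_distrib]
  refine sum_le_sum fun n hn => ?_
  have hite : ∀ P : Prop, [Decidable P] → 0 ≤ (if P then f n else 0) := fun P _ => by
    split_ifs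
    · exact hnn n
    · exact le_rfl
  have hnI := mem_Icc.1 (mem_filter.1 hn).1
  have hxn : x ≤ n := Nat.ceil_le.1 hnI.1
  have hn0 : n ≠ 0 := fun h0 => by rw [h0] at hxn; simp at hxn; linarith
  have hMn : M ^ 5 < n := by
    have : M ^ 5 ≤ k * M ^ 5 := le_mul_of_one_le_left (by positivity) hk'
    linarith
  rcases exists_coprime_factorization_or_sq_dvd n hn0 M hM hMn with hsq |
    ⟨q, b, d, hqp, hqd, rfl, hbd, hbM, hMbq, hbq, hdq⟩
  · rw [if_pos hsq, add_assoc]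
    exact le_add_of_nonneg_right (add_nonneg (hite _) (sum_nonneg fun _ _ => hite _))
  by_cases hqw : w ≤ q
  · have hmem : Nat.log q N ∈ range (N + 1) :=
      mem_range.2 (Nat.lt_succ_of_le (Nat.log_le_self _ _))
    refine le_add_of_nonneg_of_le (add_nonneg (hite _) (hite _)) ?_
    refine le_trans (le_of_eq ?_) (single_le_sum (fun _ _ => hite _) hmem)
    rw [if_pos ⟨q, b, d, hqw, rfl, rfl, hbd, hbM, hMbq, hbq, hdq⟩]
  · rw [not_le] at hqw
    refine le_add_of_le_of_nonneg (le_add_of_nonneg_of_le (hite _) ?_)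
      (sum_nonneg fun _ _ => hite _)
    have hMbw : M < b * w := hMbq.trans_le
      (mul_le_mul_of_nonneg_left (by exact_mod_cast hqw.le) (by positivity))
    rw [if_pos ⟨b, hMbw, hbM, fun p hp hpb => (hbq p hp hpb).trans hqw, dvd_mul_right _ _⟩]

end ClassSum

/-! ### Choice of parameters for large x -/

/-- Here u stands for log log x. Beyond u ≥ 1, the conditions make the ratio of the geometric series
at most e^(-2), absorb the Rankin losses, absorb the two factors of u lost to U and to the sieve,
and make fixed powers of x dominate. -/
theorem exists_forall_ge_asymptotic_conditions {α s ε : ℝ} (hα : 0 < α) (hs : 0 < s) (hε : 0 < ε)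
    (A D : ℝ) : ∃ u₀ : ℝ, ∀ u : ℝ, u₀ ≤ u → 1 ≤ u ∧ A * u ^ (-s) ≤ Real.exp (-2) ∧
      D ≤ ε * u ^ (1 / 8 : ℝ) ∧ u ^ 2 ≤ Real.exp (ε * u) ∧ 400 * u ^ 4 ≤ α * Real.exp u := by
  have h1 : ∀ᶠ u : ℝ in Filter.atTop, A * u ^ (-s) ≤ Real.exp (-2) := by
    have := (tendsto_rpow_neg_atTop hs).const_mul A
    rw [mul_zero] at this
    exact (this.eventually (gt_mem_nhds (Real.exp_pos (-2)))).mono fun u hu => hu.le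
  have h2 : ∀ᶠ u : ℝ in Filter.atTop, D ≤ ε * u ^ (1 / 8 : ℝ) :=
    ((tendsto_rpow_atTop (by norm_num : (0 : ℝ) < 1 / 8)).const_mul_atTop hε).eventually_ge_atTop D
  have h3 : ∀ᶠ u : ℝ in Filter.atTop, u ^ 2 ≤ Real.exp (ε * u) := by
    filter_upwards [(isLittleO_pow_exp_pos_mul_atTop 2 hε).bound one_pos] with u hu
    simpa [abs_of_pos (Real.exp_pos _)] using hu
  have h4 : ∀ᶠ u : ℝ in Filter.atTop, 400 * u ^ 4 ≤ α * Real.exp u := by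
    filter_upwards [(Real.isLittleO_pow_exp_atTop (n := 4)).bound
      (by positivity : 0 < α / 400)] with u hu
    rw [Real.norm_of_nonneg (by positivity), Real.norm_of_nonneg (by positivity)] at hu
    linarith
  obtain ⟨u₀, hu₀⟩ := Filter.eventually_atTop.1
    ((Filter.eventually_ge_atTop (1 : ℝ)).and (h1.and (h2.and (h3.and h4))))
  exact ⟨u₀, hu₀⟩

section Asymptotic

variable {x l u α : ℝ}

/-- M⁵ is (2x)^(α/2) while k < x^(1-α), so about x^(α/2) is left over; the error term of the sieve
has to fit into this room. -/
theorem mul_rpow_pow_five_le (hxl : x = Real.exp l) (hl : 1 ≤ l) (hα : 0 < α) (hα' : α < 1 / 2)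
    {k : ℕ} (hk : 0 < k) (hkx : (k : ℝ) < x ^ (1 - α)) :
    k * ((2 * x) ^ (α / 10)) ^ 5 * x ^ (α / 2) < 2 * x ∧ k * ((2 * x) ^ (α / 10)) ^ 5 < x := by
  have hx2 : 2 ≤ x := by
    rw [hxl]; linarith [Real.add_one_le_exp l]
  have hx0 : 0 < x := by linarith
  have e : ((2 * x) ^ (α / 10)) ^ 5 = 2 ^ (α / 2) * x ^ (α / 2) := by
    rw [← Real.rpow_natCast, ← Real.rpow_mul (by positivity), ← Real.mul_rpow (by norm_num) hx0.le]
    congr 1; push_cast; ring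
  have h2 : (2 : ℝ) ^ (α / 2) ≤ 2 := by
    calc (2 : ℝ) ^ (α / 2) ≤ 2 ^ (1 : ℝ) :=
          Real.rpow_le_rpow_of_exponent_le (by norm_num) (by linarith)
      _ = 2 := Real.rpow_one 2
  have h3 : (2 : ℝ) ^ (α / 2) ≤ x ^ (α / 2) := Real.rpow_le_rpow (by norm_num) hx2 (by linarith)
  rw [e]
  have hx1 : x ^ (1 - α) * x ^ (α / 2) * x ^ (α / 2) = x := by
    rw [← Real.rpow_add hx0, ← Real.rpow_add hx0]
    conv_rhs => rw [← Real.rpow_one x]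
    congr 1; ring
  have ha0 : 0 < x ^ (α / 2) := by positivity
  have h4 : (k : ℝ) * x ^ (α / 2) * x ^ (α / 2) < x :=
    (mul_lt_mul_of_pos_right (mul_lt_mul_of_pos_right hkx ha0) ha0).trans_eq hx1
  have h5 : 0 < (k : ℝ) * x ^ (α / 2) := by positivity
  have h6 : 0 < (k : ℝ) * x ^ (α / 2) * x ^ (α / 2) := by positivity
  constructor
  · calc (k : ℝ) * (2 ^ (α / 2) * x ^ (α / 2)) * x ^ (α / 2)
        = 2 ^ (α / 2) * (k * x ^ (α / 2) * x ^ (α / 2)) := by ring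
      _ ≤ 2 * (k * x ^ (α / 2) * x ^ (α / 2)) := mul_le_mul_of_nonneg_right h2 h6.le
      _ < 2 * x := by linarith
  · calc (k : ℝ) * (2 ^ (α / 2) * x ^ (α / 2)) = 2 ^ (α / 2) * (k * x ^ (α / 2)) := by ring
      _ ≤ x ^ (α / 2) * (k * x ^ (α / 2)) := mul_le_mul_of_nonneg_right h3 h5.le
      _ = k * x ^ (α / 2) * x ^ (α / 2) := by ring
      _ < x := h4

/-- The level x^(α/(8h)) is balanced: Y^(2h) ≤ x^(α/4) keeps the sieve error small, while log Y
still exceeds a constant times (log x)/u because h ≤ 18u. -/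
theorem two_le_floor_and_pow_le (hxl : x = Real.exp l) (hlu : l = Real.exp u) (hu : 1 ≤ u)
    (hα : 0 < α) (hα' : α < 1 / 2) (hbig : 400 * u ^ 4 ≤ α * Real.exp u) {h : ℕ}
    (hh : h = ⌈17 * u⌉₊) :
    2 ≤ ⌊x ^ (α / (8 * h))⌋₊ ∧ ⌊x ^ (α / (8 * h))⌋₊ ^ (h + 1) ≤ ⌊2 * x⌋₊ ∧
      α * l / (16 * (18 * u)) ≤ Real.log ⌊x ^ (α / (8 * h))⌋₊ ∧
      ((⌊x ^ (α / (8 * h))⌋₊ : ℝ)) ^ (2 * h) ≤ x ^ (α / 4) := by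
  have hl : 1 ≤ l := by rw [hlu]; linarith [Real.add_one_le_exp u]
  have hx2 : 2 ≤ x := by
    rw [hxl]; linarith [Real.add_one_le_exp l]
  have hx0 : 0 < x := by linarith
  have hh1 : (h : ℝ) ≤ 18 * u := by
    rw [hh]; linarith [Nat.ceil_lt_add_one (show 0 ≤ 17 * u by linarith)]
  have hh0 : (1 : ℝ) ≤ h := by
    have := Nat.le_ceil (17 * u)
    rw [← hh] at this
    linarith
  have hu4 : u ≤ u ^ 4 := le_self_pow₀ hu (by norm_num)
  set y := x ^ (α / (8 * h)) with hy
  have hylog : Real.log y = α / (8 * h) * l := by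
    rw [hy, Real.log_rpow hx0, hxl, Real.log_exp]
  have hαl : 400 * u ≤ α * l := by rw [hlu]; linarith
  have hylog' : α * l / (8 * (18 * u)) ≤ Real.log y := by
    rw [hylog, div_mul_eq_mul_div]
    exact div_le_div_of_nonneg_left (by positivity) (by positivity) (by linarith)
  have hu0 : 0 < u := by linarith
  have hlow : 1 ≤ α * l / (16 * (18 * u)) := by
    rw [one_le_div (by positivity)]; linarith
  have hhalf : α * l / (8 * (18 * u)) = 2 * (α * l / (16 * (18 * u))) := by
    field_simp; norm_num
  have hy0 : 0 < y := by positivity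
  have hy2 : 2 ≤ y := by
    have h1 : Real.log y + 1 ≤ y := by
      have := Real.add_one_le_exp (Real.log y)
      rwa [Real.exp_log hy0] at this
    linarith
  have hY2 : 2 ≤ ⌊y⌋₊ := Nat.le_floor (by exact_mod_cast hy2)
  have hYy : (⌊y⌋₊ : ℝ) ≤ y := Nat.floor_le hy0.le
  refine ⟨hY2, ?_, ?_, ?_⟩
  · refine Nat.le_floor ?_
    push_cast
    calc (⌊y⌋₊ : ℝ) ^ (h + 1) ≤ y ^ (h + 1) := pow_le_pow_left₀ (by positivity) hYy _
      _ = x ^ (α / (8 * h) * (h + 1)) := by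
          rw [hy, ← Real.rpow_natCast, ← Real.rpow_mul hx0.le]; push_cast; rfl
      _ ≤ x ^ (1 : ℝ) := by
          refine Real.rpow_le_rpow_of_exponent_le (by linarith) ?_
          rw [div_mul_eq_mul_div, div_le_one (by positivity)]
          nlinarith
      _ ≤ 2 * x := by rw [Real.rpow_one]; linarith
  · have h1 : y / 2 ≤ ⌊y⌋₊ := by linarith [Nat.lt_floor_add_one y]
    have h2 := Real.log_le_log (by positivity) h1
    rw [Real.log_div hy0.ne' (by norm_num)] at h2
    linarith [Real.log_two_lt_d9]
  · calc (⌊y⌋₊ : ℝ) ^ (2 * h) ≤ y ^ (2 * h) := pow_le_pow_left₀ (by positivity) hYy _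
      _ = x ^ (α / (8 * h) * (2 * h)) := by
          rw [hy, ← Real.rpow_natCast, ← Real.rpow_mul hx0.le]; push_cast; rfl
      _ = x ^ (α / 4) := by
          congr 1; field_simp; norm_num

theorem card_sifted_dyadicClass_le_of_large (hxl : x = Real.exp l) (hlu : l = Real.exp u)
    (hu : 1 ≤ u) (hα : 0 < α) (hα' : α < 1 / 2) (hbig : 400 * u ^ 4 ≤ α * Real.exp u) {h : ℕ}
    (hh : h = ⌈17 * u⌉₊) {k : ℕ} (hk : 0 < k) (hkx : (k : ℝ) < x ^ (1 - α)) (a : ℤ)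
    {b : ℕ} (hb : 0 < b) (hbk : b.Coprime k) (hbM : (b : ℝ) ≤ ((2 * x) ^ (α / 10)) ^ 5) :
    (((dyadicClass x k a).filter (fun n => b ∣ n ∧
      ∀ p ∈ Nat.primesBelow ⌊x ^ (α / (8 * h))⌋₊, ¬ p ∣ k → ¬ p * b ∣ n)).card : ℝ) ≤
      (288 / α + Real.exp 18 + 1) * u * x / (k.totient * l) / b := by
  have hl : 1 ≤ l := by rw [hlu]; linarith [Real.add_one_le_exp u]
  have hx2 : 2 ≤ x := by
    rw [hxl]; linarith [Real.add_one_le_exp l]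
  have hx0 : 0 < x := by linarith
  have hl0 : 0 < l := by linarith
  have hu0 : 0 < u := by linarith
  obtain ⟨hY2, -, hYlog, hYpow⟩ := two_le_floor_and_pow_le hxl hlu hu hα hα' hbig hh
  obtain ⟨hkM, -⟩ := mul_rpow_pow_five_le hxl hl hα hα' hk hkx
  have key := card_sifted_dyadicClass_le (x := x) (by linarith) hk hb hbk a hY2 h
  set Y := ⌊x ^ (α / (8 * h))⌋₊ with hY
  have hk' : (0 : ℝ) < k := by exact_mod_cast hk
  have hb' : (0 : ℝ) < b := by exact_mod_cast hb
  have hφ : (0 : ℝ) < k.totient := by exact_mod_cast Nat.totient_pos.2 hk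
  have hφk : (k.totient : ℝ) ≤ k := by exact_mod_cast Nat.totient_le k
  have hu4 : u ≤ u ^ 4 := le_self_pow₀ hu (by norm_num)
  refine key.trans ?_
  have hlow0 : 0 < α * l / (16 * (18 * u)) := by positivity
  have t1 : (k : ℝ) / (k.totient * Real.log Y) ≤ (k : ℝ) / k.totient * (288 / α * u / l) := by
    calc (k : ℝ) / (k.totient * Real.log Y) ≤ k / (k.totient * (α * l / (16 * (18 * u)))) :=
          div_le_div_of_nonneg_left hk'.le (by positivity)
            (mul_le_mul_of_nonneg_left hYlog hφ.le)
      _ = _ := by field_simp; norm_num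
  have hYx : (Y : ℝ) ≤ x := by
    have hh0 : (1 : ℝ) ≤ h := by
      have := Nat.le_ceil (17 * u)
      rw [← hh] at this
      linarith
    refine (Nat.floor_le (by positivity)).trans ?_
    calc x ^ (α / (8 * h)) ≤ x ^ (1 : ℝ) := by
          refine Real.rpow_le_rpow_of_exponent_le (by linarith) ?_
          rw [div_le_one (by positivity)]
          linarith
      _ = x := Real.rpow_one x
  have t2 : (1 / 4 : ℝ) ^ h * Real.exp (2 * ∑ p ∈ Nat.primesBelow Y, (1 : ℝ) / p) ≤
      (k : ℝ) / k.totient * (Real.exp 18 / l) := by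
    have hsum : ∑ p ∈ Nat.primesBelow Y, (1 : ℝ) / p ≤ 9 + 8 * u := by
      refine le_trans (sum_le_sum_of_subset_of_nonneg (t := Nat.primesBelow (Y + 1)) ?_
        fun _ _ _ => by positivity) (sum_inv_primesBelow_le Y u (by linarith) ?_)
      · intro p hp
        rw [Nat.mem_primesBelow] at hp ⊢
        exact ⟨by omega, hp.2⟩
      · rw [← hlu, ← Real.log_exp l, ← hxl]
        exact Real.log_le_log (by exact_mod_cast (by omega : 0 < Y)) hYx
    have hpow : (1 / 4 : ℝ) ^ h ≤ Real.exp (-(17 * u)) := by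
      have h1 : (1 / 4 : ℝ) ≤ Real.exp (-1) := by
        rw [Real.exp_neg, one_div]
        refine inv_anti₀ (Real.exp_pos 1) ?_
        linarith [Real.exp_one_lt_d9]
      calc (1 / 4 : ℝ) ^ h ≤ (Real.exp (-1)) ^ h := pow_le_pow_left₀ (by norm_num) h1 h
        _ = Real.exp (-(h : ℝ)) := by rw [← Real.exp_nat_mul]; congr 1; ring
        _ ≤ _ := Real.exp_le_exp.2 (neg_le_neg (by rw [hh]; exact Nat.le_ceil _))
    -- The 17 in h is chosen here: e^(-17u) against exp(2(9 + 8u)) leaves e^18 e^(-u) = e^18 / l.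
    calc (1 / 4 : ℝ) ^ h * Real.exp (2 * ∑ p ∈ Nat.primesBelow Y, (1 : ℝ) / p)
        ≤ Real.exp (-(17 * u)) * Real.exp (2 * (9 + 8 * u)) :=
          mul_le_mul hpow (Real.exp_le_exp.2 (by linarith)) (by positivity) (by positivity)
      _ = Real.exp 18 / l := by
          rw [hlu, ← Real.exp_add, ← Real.exp_sub]; congr 1; ring
      _ ≤ _ := le_mul_of_one_le_left (by positivity) ((one_le_div hφ).2 hφk)
  have t3 : 2 * (Y : ℝ) ^ (2 * h) ≤ x / (k * b) * ((k : ℝ) / k.totient * (1 / l)) := by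
    have h1 : x ^ (α / 4) * x ^ (α / 4) = x ^ (α / 2) := by
      rw [← Real.rpow_add hx0]; congr 1; ring
    have h2 : 4 * l ≤ x ^ (α / 4) := by
      have h3 : x ^ (α / 4) = Real.exp (α / 4 * l) := by
        rw [hxl, ← Real.exp_mul]; congr 1; ring
      have h4 : 4 * l ≤ Real.exp (2 + u) := by
        rw [Real.exp_add, ← hlu]
        have : (4 : ℝ) ≤ Real.exp 2 := by
          have h5 := Real.add_one_le_exp (1 : ℝ)
          have h6 : Real.exp 2 = Real.exp 1 * Real.exp 1 := by rw [← Real.exp_add]; norm_num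
          nlinarith
        nlinarith
      rw [h3]
      refine h4.trans (Real.exp_le_exp.2 ?_)
      rw [hlu]
      linarith
    have h3 : x ^ (α / 2) ≤ 2 * (x / (k * b)) := by
      rw [← mul_div_assoc, le_div_iff₀ (by positivity)]
      have : k * b * x ^ (α / 2) ≤ k * ((2 * x) ^ (α / 10)) ^ 5 * x ^ (α / 2) := by gcongr
      linarith
    have h4 : 2 * x ^ (α / 4) ≤ x / (k * b) * (1 / l) := by
      rw [mul_one_div, le_div_iff₀ hl0]
      have h5 : 0 < x ^ (α / 4) := by positivity
      nlinarith
    calc 2 * (Y : ℝ) ^ (2 * h) ≤ 2 * x ^ (α / 4) := by linarith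
      _ ≤ x / (k * b) * (1 / l) := h4
      _ ≤ _ := mul_le_mul_of_nonneg_left (le_mul_of_one_le_left (by positivity)
          ((one_le_div hφ).2 hφk)) (by positivity)
  calc x / (k * b) * (k / (k.totient * Real.log Y) +
        (1 / 4) ^ h * Real.exp (2 * ∑ p ∈ Nat.primesBelow Y, (1 : ℝ) / p)) +
        2 * (Y : ℝ) ^ (2 * h)
      ≤ x / (k * b) * ((k : ℝ) / k.totient * (288 / α * u / l) +
        (k : ℝ) / k.totient * (Real.exp 18 / l)) +
        x / (k * b) * ((k : ℝ) / k.totient * (1 / l)) := by gcongr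
    _ = (288 / α * u + Real.exp 18 * 1 + 1) * x / (k.totient * l) / b := by field_simp
    _ ≤ (288 / α * u + Real.exp 18 * u + u) * x / (k.totient * l) / b := by gcongr
    _ = _ := by ring

/-- The contribution of the integers with a large square divisor or a large smooth divisor. -/
theorem exceptional_le_of_large (hxl : x = Real.exp l) (hlu : l = Real.exp u)
    (hu : 1 ≤ u) (hα : 0 < α) (hα' : α < 1 / 2) (hbig : 400 * u ^ 4 ≤ α * Real.exp u) :
    (2 * x) ^ (α / 80) * (2 / (2 * x) ^ (α / 10) +
      (⌈u ^ 4⌉₊ / (2 * x) ^ (α / 10)) ^ (1 / 2 : ℝ) * 4 ^ ⌈u ^ 4⌉₊) ≤ 1 / l := by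
  have hl : 1 ≤ l := by rw [hlu]; linarith [Real.add_one_le_exp u]
  have hx2 : 2 ≤ x := by
    rw [hxl]; linarith [Real.add_one_le_exp l]
  have hx0 : 0 < 2 * x := by linarith
  have hl0 : 0 < l := by linarith
  have hu4 : u ≤ u ^ 4 := le_self_pow₀ hu (by norm_num)
  set w := ⌈u ^ 4⌉₊ with hw
  have hw1 : (1 : ℝ) ≤ w := by
    have := Nat.le_ceil (u ^ 4)
    linarith
  have hwn : 1 ≤ w := by exact_mod_cast hw1
  have hw2 : (w : ℝ) ≤ u ^ 4 + 1 := (Nat.ceil_lt_add_one (by positivity)).le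
  have e1 : 2 / (2 * x) ^ (α / 10) ≤ 2 * (2 * x) ^ (-(α / 20)) := by
    rw [div_eq_mul_inv, ← Real.rpow_neg hx0.le]
    exact mul_le_mul_of_nonneg_left
      (Real.rpow_le_rpow_of_exponent_le (by linarith) (by linarith)) (by norm_num)
  have e2 : (w / (2 * x) ^ (α / 10)) ^ (1 / 2 : ℝ) ≤ 2 ^ w * (2 * x) ^ (-(α / 20)) := by
    rw [div_eq_mul_inv, ← Real.rpow_neg hx0.le, Real.mul_rpow (by positivity) (by positivity),
      ← Real.rpow_mul hx0.le]
    have h1 : -(α / 10) * (1 / 2) = -(α / 20) := by ring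
    rw [h1]
    refine mul_le_mul_of_nonneg_right ?_ (by positivity)
    calc (w : ℝ) ^ (1 / 2 : ℝ) ≤ (w : ℝ) ^ (1 : ℝ) :=
          Real.rpow_le_rpow_of_exponent_le hw1 (by norm_num)
      _ = w := Real.rpow_one _
      _ ≤ 2 ^ w := by exact_mod_cast Nat.lt_two_pow_self.le
  have e3 : (2 : ℝ) + 8 ^ w ≤ Real.exp (3 * w) := by
    have h1 : (2 : ℝ) + 8 ^ w ≤ 16 ^ w := by
      have h2 : (2 : ℝ) ^ 1 ≤ 2 ^ w := pow_le_pow_right₀ (by norm_num) hwn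
      have h3 : (8 : ℝ) ^ 1 ≤ 8 ^ w := pow_le_pow_right₀ (by norm_num) hwn
      have h4 : (16 : ℝ) ^ w = 2 ^ w * 8 ^ w := by rw [← mul_pow]; norm_num
      rw [h4]
      nlinarith
    refine h1.trans ?_
    rw [mul_comm, Real.exp_nat_mul]
    refine pow_le_pow_left₀ (by norm_num) ?_ w
    have h5 : Real.exp 3 = Real.exp 1 ^ 3 := by rw [← Real.exp_nat_mul]; norm_num
    have h6 := Real.exp_one_gt_d9
    rw [h5]
    calc (16 : ℝ) ≤ 2.7182818283 ^ 3 := by norm_num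
      _ ≤ _ := pow_le_pow_left₀ (by norm_num) h6.le 3
  have e4 : (2 * x) ^ (α / 80) * (2 * x) ^ (-(α / 20)) ≤ Real.exp (-(3 * α / 80) * l) := by
    rw [← Real.rpow_add hx0]
    have h1 : α / 80 + -(α / 20) = -(3 * α / 80) := by ring
    rw [h1]
    calc (2 * x) ^ (-(3 * α / 80)) ≤ x ^ (-(3 * α / 80)) :=
          Real.rpow_le_rpow_of_nonpos (by linarith) (by linarith)
            (by rw [neg_nonpos]; positivity)
      _ = _ := by rw [hxl, ← Real.exp_mul]; congr 1; ring
  calc _ ≤ (2 * x) ^ (α / 80) * (2 * (2 * x) ^ (-(α / 20)) +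
        2 ^ w * (2 * x) ^ (-(α / 20)) * 4 ^ w) := by gcongr
    _ = ((2 * x) ^ (α / 80) * (2 * x) ^ (-(α / 20))) * (2 + 8 ^ w) := by
        have : (8 : ℝ) ^ w = 2 ^ w * 4 ^ w := by rw [← mul_pow]; norm_num
        rw [this]; ring
    _ ≤ Real.exp (-(3 * α / 80) * l) * Real.exp (3 * w) :=
        mul_le_mul e4 e3 (by positivity) (by positivity)
    -- Since αl ≥ 400u⁴, the term 3αl/80 is at least 15u⁴, whereas 3w + u ≤ 7u⁴.
    _ ≤ Real.exp (-u) := by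
        rw [← Real.exp_add]
        refine Real.exp_le_exp.2 ?_
        rw [← hlu] at hbig
        nlinarith
    _ = 1 / l := by rw [Real.exp_neg, ← hlu, one_div]

/-- With U = u^(1/2) and β < 1/8, each of B², BU log U and w = ⌈4B²⌉ is O(u^(7/8)), so the whole
loss in the exponent is at most εu. -/
theorem sum_rankin_le_of_large {f : ArithmeticFunction ℝ} {A K β ε : ℝ} (hu : 1 ≤ u)
    (hA : 1 ≤ A) (hβ : 0 < β) (hβ' : β < 1 / 8)
    (hf : f.IsMultiplicative) (hnn : ∀ n, 0 ≤ f n)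
    (hB : ∀ p l : ℕ, p.Prime → 1 ≤ l → f (p ^ l) ≤ (A * u ^ β) ^ l)
    (hK : ∀ n : ℕ, 1 ≤ n → f n ≤ K * (n : ℝ) ^ (1 / 8 : ℝ))
    (hD : 8 * A ^ 2 + 2 + 8 * A + 2 * A ^ 2 * ∑' n : ℕ, (n : ℝ) ^ (-(3 / 2) : ℝ) ≤
      ε * u ^ (1 / 8 : ℝ)) {k r : ℕ} {lam : ℝ} (hx : 1 ≤ x)
    (hlam : lam * Real.log (2 * x) = Real.log (u ^ (1 / 2 : ℝ))) (hr : (r : ℝ) * lam ≤ 1 / 8)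
    (S : Finset ℕ) (hS0 : ∀ b ∈ S, b ≠ 0 ∧ (b : ℝ) ≤ x)
    (hS : ∀ b ∈ S, ∀ p : ℕ, p.Prime → p ∣ b → p ^ r ≤ ⌊2 * x⌋₊ ∧ ¬ p ∣ k) :
    ∑ b ∈ S, f b * (b : ℝ) ^ (r * lam - 1) ≤
      K * Real.exp (ε * u + primeSumCoprime f x k) := by
  have hu0 : 0 < u := by linarith
  have hl2 : 0 < Real.log (2 * x) := Real.log_pos (by linarith)
  set U := u ^ (1 / 2 : ℝ) with hU
  have hU1 : 1 ≤ U := Real.one_le_rpow hu (by norm_num)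
  have hlam0 : 0 ≤ lam := by
    by_contra hneg
    have := Real.log_nonneg hU1
    nlinarith [not_le.1 hneg]
  set B := A * u ^ β with hBdef
  have hB1 : 1 ≤ B := one_le_mul_of_one_le_of_one_le hA (Real.one_le_rpow hu hβ.le)
  have hK0 : 0 ≤ K := by
    have := (hnn 1).trans (hK 1 le_rfl)
    simpa using this
  set Q := (Icc 1 ⌊x⌋₊).filter (fun p : ℕ => p.Prime ∧ ¬ p ∣ k) with hQ
  set P := Q.filter (fun p => p ^ r ≤ ⌊2 * x⌋₊) with hP
  have hPp : ∀ p ∈ P, p.Prime ∧ p ^ r ≤ ⌊2 * x⌋₊ := fun p hp => by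
    rw [hP, mem_filter, hQ, mem_filter] at hp
    exact ⟨hp.1.2.1, hp.2⟩
  have hδN : (r * lam) * Real.log (P.sup id : ℕ) ≤ Real.log U := by
    rcases P.eq_empty_or_nonempty with h0 | h0
    -- The supremum of the empty set is 0, and `Real.log 0 = 0`.
    · rw [h0]
      simpa using Real.log_nonneg hU1
    · obtain ⟨p, hp, hps⟩ := exists_mem_eq_sup P h0 id
      rw [hps, id]
      have hp0 : (0 : ℝ) < p := by exact_mod_cast (hPp p hp).1.pos
      have h2 : (p : ℝ) ^ r ≤ 2 * x :=
        le_trans (by exact_mod_cast (hPp p hp).2) (Nat.floor_le (by linarith))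
      have h3 : (r : ℝ) * Real.log p ≤ Real.log (2 * x) := by
        rw [← Real.log_pow]; exact Real.log_le_log (by positivity) h2
      calc (r * lam) * Real.log p = lam * (r * Real.log p) := by ring
        _ ≤ lam * Real.log (2 * x) := mul_le_mul_of_nonneg_left h3 hlam0
        _ = _ := hlam
  set w := ⌈4 * B ^ 2⌉₊ with hw
  have key := sum_rankin_le_exp hf hnn hB1 hB hK (by positivity : 0 ≤ (r : ℝ) * lam) hr P
    (P.sup id) (fun p hp => ⟨(hPp p hp).1, le_sup (f := id) hp⟩) U hU1 hδN w (Nat.le_ceil _) S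
    (fun b hb => (hS0 b hb).1) (fun b hb p hp hpb => by
      obtain ⟨hb0, hbx⟩ := hS0 b hb
      obtain ⟨h1, h2⟩ := hS b hb p hp hpb
      refine mem_filter.2 ⟨mem_filter.2 ⟨mem_Icc.2 ⟨hp.pos, Nat.le_floor ?_⟩, hp, h2⟩, h1⟩
      exact le_trans (by exact_mod_cast Nat.le_of_dvd (Nat.pos_of_ne_zero hb0) hpb) hbx)
  refine key.trans ?_
  set Z := ∑' n : ℕ, (n : ℝ) ^ (-(3 / 2) : ℝ) with hZ
  have hZ0 : 0 ≤ Z := tsum_nonneg fun _ => by positivity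
  have hE : ∑ p ∈ P, f p / (p : ℝ) ≤ primeSumCoprime f x k :=
    sum_le_sum_of_subset_of_nonneg (filter_subset _ _) fun p _ _ => by
      have := hnn p
      positivity
  set v := u ^ (7 / 8 : ℝ) with hv
  have hv1 : 1 ≤ v := Real.one_le_rpow hu (by norm_num)
  have hB2 : B ^ 2 ≤ A ^ 2 * v := by
    rw [hBdef, mul_pow]
    refine mul_le_mul_of_nonneg_left ?_ (by positivity)
    rw [← Real.rpow_natCast, ← Real.rpow_mul hu0.le]
    exact Real.rpow_le_rpow_of_exponent_le hu (by push_cast; linarith)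
  have hBU : B * U * Real.log U ≤ 2 * A * v := by
    have h1 : Real.log U ≤ 2 * u ^ (1 / 4 : ℝ) := by
      have := Real.log_le_rpow_div hu0.le (by norm_num : (0 : ℝ) < 1 / 4)
      rw [hU, Real.log_rpow hu0]
      linarith
    calc B * U * Real.log U ≤ B * U * (2 * u ^ (1 / 4 : ℝ)) :=
          mul_le_mul_of_nonneg_left h1 (by positivity)
      _ = 2 * A * u ^ (β + 1 / 2 + 1 / 4) := by
          rw [Real.rpow_add hu0, Real.rpow_add hu0, hBdef, hU]; ring
      _ ≤ _ := mul_le_mul_of_nonneg_left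
          (Real.rpow_le_rpow_of_exponent_le hu (by linarith)) (by positivity)
  have hwle : (w : ℝ) ≤ 4 * A ^ 2 * v + v := by
    have := Nat.ceil_lt_add_one (show 0 ≤ 4 * B ^ 2 by positivity)
    linarith
  have h4w : (4 : ℝ) ^ w ≤ Real.exp (2 * w) := by
    rw [mul_comm, Real.exp_nat_mul]
    refine pow_le_pow_left₀ (by norm_num) ?_ w
    have h5 : Real.exp 2 = Real.exp 1 * Real.exp 1 := by rw [← Real.exp_add]; norm_num
    have h6 := Real.add_one_le_exp (1 : ℝ)
    nlinarith
  have hvu : (8 * A ^ 2 + 2 + 8 * A + 2 * A ^ 2 * Z) * v ≤ ε * u := by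
    have h1 : u ^ (1 / 8 : ℝ) * v = u := by
      rw [hv, ← Real.rpow_add hu0]; norm_num
    calc _ ≤ ε * u ^ (1 / 8 : ℝ) * v := mul_le_mul_of_nonneg_right hD (by linarith)
      _ = ε * u := by rw [mul_assoc, h1]
  calc K * 4 ^ w * Real.exp (∑ p ∈ P, f p / p + 2 * B * U * Real.log U + 2 * B ^ 2 * Z)
      ≤ K * Real.exp (2 * w) *
        Real.exp (∑ p ∈ P, f p / p + 2 * B * U * Real.log U + 2 * B ^ 2 * Z) := by gcongr
    _ = K * Real.exp (2 * w + (∑ p ∈ P, f p / p + 2 * B * U * Real.log U + 2 * B ^ 2 * Z)) := by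
        rw [mul_assoc, ← Real.exp_add]
    _ ≤ _ := by
        refine mul_le_mul_of_nonneg_left (Real.exp_le_exp.2 ?_) hK0
        have h1 : B ^ 2 * Z ≤ A ^ 2 * v * Z := mul_le_mul_of_nonneg_right hB2 hZ0
        have h2 : 0 ≤ A * v := by positivity
        nlinarith

end Asymptotic

/-! ### Bounds from the class hypotheses, and the theorem -/

namespace MemShiuClass

variable {β A₁ x : ℝ} {A₂ A₃ : ℝ → ℝ} {f : ArithmeticFunction ℝ}

theorem prime_pow_le_pow (hf : MemShiuClass β A₁ A₂ A₃ x f)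
    (hu : 1 ≤ Real.log (Real.log x)) (p l : ℕ) (hp : p.Prime) (hl : 1 ≤ l) :
    f (p ^ l) ≤ (max 1 |A₁| * Real.log (Real.log x) ^ β) ^ l := by
  refine (hf.prime_pow_le p l hp hl).trans ?_
  rw [mul_pow, Real.rpow_mul (by linarith), Real.rpow_natCast]
  refine mul_le_mul_of_nonneg_right ?_ (by positivity)
  calc A₁ ^ l ≤ |A₁ ^ l| := le_abs_self _
    _ = |A₁| ^ l := abs_pow _ _
    _ ≤ _ := pow_le_pow_left₀ (abs_nonneg _) (le_max_right _ _) l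

/-- The maximum is replaced by a product of factors that are at least 1. Keeping ε and η apart
allows a tiny power of log x together with the fixed exponent 1/8 that Rankin's method needs. -/
theorem le_mul_rpow (hf : MemShiuClass β A₁ A₂ A₃ x f) (hl : 1 ≤ Real.log x) {ε η : ℝ}
    (hε : 0 < ε) (hεη : ε ≤ η) (n : ℕ) (hn : 1 ≤ n) :
    f n ≤ (|A₂ ε| + |A₃ ε|) * Real.log x ^ ε * (n : ℝ) ^ η := by
  have hn' : (1 : ℝ) ≤ n := by exact_mod_cast hn
  have h1 : 1 ≤ Real.log x ^ ε := Real.one_le_rpow hl hε.le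
  have h2 : 1 ≤ (n : ℝ) ^ η := Real.one_le_rpow hn' (hε.le.trans hεη)
  have h3 : (n : ℝ) ^ ε ≤ (n : ℝ) ^ η := Real.rpow_le_rpow_of_exponent_le hn' hεη
  refine (hf.le_max ε hε n hn).trans (max_le ?_ ?_)
  · calc A₂ ε * (n : ℝ) ^ ε ≤ |A₂ ε| * (1 * (n : ℝ) ^ η) := by
          rw [one_mul]
          exact mul_le_mul (le_abs_self _) h3 (by positivity) (abs_nonneg _)
      _ ≤ |A₂ ε| * (Real.log x ^ ε * (n : ℝ) ^ η) := by gcongr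
      _ ≤ _ := by
          rw [mul_assoc]
          exact mul_le_mul_of_nonneg_right (le_add_of_nonneg_right (abs_nonneg _)) (by positivity)
  · calc A₃ ε * Real.log x ^ ε ≤ |A₃ ε| * (Real.log x ^ ε * 1) := by
          rw [mul_one]
          exact mul_le_mul_of_nonneg_right (le_abs_self _) (by positivity)
      _ ≤ |A₃ ε| * (Real.log x ^ ε * (n : ℝ) ^ η) := by gcongr
      _ ≤ _ := by
          rw [mul_assoc]
          exact mul_le_mul_of_nonneg_right (le_add_of_nonneg_left (abs_nonneg _)) (by positivity)

theorem le_mul_rpow_of_le_two_mul (hf : MemShiuClass β A₁ A₂ A₃ x f) (hl : 0 ≤ Real.log x)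
    (hx : 1 ≤ x) {ε : ℝ} (hε : 0 < ε) (n : ℕ) (hn : 1 ≤ n) (hnx : (n : ℝ) ≤ 2 * x) :
    f n ≤ (|A₂ ε| + |A₃ ε|) * (2 * x) ^ ε := by
  have hlx : Real.log x ≤ 2 * x := by
    linarith [Real.log_le_sub_one_of_pos (by linarith : 0 < x)]
  refine (hf.le_max ε hε n hn).trans (max_le ?_ ?_)
  · refine mul_le_mul ((le_abs_self _).trans (le_add_of_nonneg_right (abs_nonneg _)))
      (Real.rpow_le_rpow (by positivity) hnx hε.le) (by positivity) (by positivity)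
  · refine mul_le_mul ((le_abs_self _).trans (le_add_of_nonneg_left (abs_nonneg _)))
      (Real.rpow_le_rpow hl hlx hε.le) (by positivity) (by positivity)

end MemShiuClass

theorem shortProgressionSum_le_sum_dyadicClass {f : ArithmeticFunction ℝ} (hnn : ∀ n, 0 ≤ f n)
    {x y : ℝ} (hyx : y ≤ x) (k : ℕ) (a : ℤ) :
    shortProgressionSum f x y k a ≤ ∑ n ∈ dyadicClass x k a, f n := by
  refine sum_le_sum_of_subset_of_nonneg (filter_subset_filter _ ?_) fun n _ _ => hnn n
  exact Icc_subset_Icc le_rfl (Nat.floor_le_floor (by linarith))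

theorem mainTheorem1 (α κ β : ℝ) (hα : 0 < α) (hα' : α < 1 / 2) (hκ : 0 < κ) (hκ' : κ < 1 / 2)
    (hβ : 0 < β) (hβ' : β < α * κ / 41) (A₁ : ℝ) (A₂ A₃ : ℝ → ℝ) (ε₀ : ℝ) (hε₀ : 0 < ε₀) :
    ∃ C x₀ : ℝ, ∀ x : ℝ, x₀ ≤ x →
      ∀ f : ArithmeticFunction ℝ, MemShiuClass β A₁ A₂ A₃ x f →
      ∀ y : ℝ, x ^ κ ≤ y → y ≤ x →
      ∀ k : ℕ, 0 < k → (k : ℝ) < y ^ (1 - α) →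
      ∀ a : ℤ, IsCoprime a (k : ℤ) →
        shortProgressionSum f x y k a ≤
          C * (x / ((Nat.totient k : ℝ) * (Real.log x) ^ (1 - ε₀)) *
            Real.exp (primeSumCoprime f x k)) := by
  have hβα : β < α / 82 := by linarith [mul_lt_mul_of_pos_left hκ' hα]
  set A := max 1 |A₁| with hA
  have hA1 : 1 ≤ A := le_max_left _ _
  -- Three factors e^(εu) must fit into e^(ε₀u): one from the pointwise bound on f, one from the
  -- Rankin loss, one from u². The cap 1/8 permits n^ε ≤ n^(1/8).
  set ε := min (1 / 8) (ε₀ / 8) with hε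
  have hε0 : 0 < ε := by positivity
  have hε8 : ε ≤ 1 / 8 := min_le_left _ _
  have hεε₀ : ε ≤ ε₀ / 8 := min_le_right _ _
  obtain ⟨u₀, hu₀⟩ := exists_forall_ge_asymptotic_conditions hα
    (by linarith : 0 < α / 20 - β) hε0 A
    (8 * A ^ 2 + 2 + 8 * A + 2 * A ^ 2 * ∑' n : ℕ, (n : ℝ) ^ (-(3 / 2) : ℝ))
  set c₁ := |A₂ (α / 80)| + |A₃ (α / 80)| with hc₁
  set c₂ := |A₂ ε| + |A₃ ε| with hc₂
  set c₃ := 288 / α + Real.exp 18 + 1 with hc₃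
  have hc₁0 : 0 ≤ c₁ := by positivity
  have hc₂0 : 0 ≤ c₂ := by positivity
  have hc₃0 : 0 ≤ c₃ := by positivity
  refine ⟨c₁ * 3 + c₂ * (2 * c₃ + 6), Real.exp (Real.exp u₀), ?_⟩
  intro x hx f hf y hxy hyx k hk hky a ha
  set l := Real.log x with hl
  set u := Real.log l with hu
  have hx0 : 0 < x := (Real.exp_pos _).trans_le hx
  have hxl : x = Real.exp l := (Real.exp_log hx0).symm
  have hul : Real.exp u₀ ≤ l := (Real.le_log_iff_exp_le hx0).2 hx
  have hl0 : 0 < l := (Real.exp_pos _).trans_le hul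
  have hlu : l = Real.exp u := (Real.exp_log hl0).symm
  obtain ⟨hu1, hcA, hcD, hcu, hbig⟩ := hu₀ u ((Real.le_log_iff_exp_le hl0).2 hul)
  have hu0 : 0 < u := by linarith
  have hl1 : 1 ≤ l := by rw [hlu]; linarith [Real.add_one_le_exp u]
  have hx2 : 2 ≤ x := by rw [hxl]; linarith [Real.add_one_le_exp l]
  have hx1 : 1 ≤ x := by linarith
  have hkx : (k : ℝ) < x ^ (1 - α) := hky.trans_le
    (Real.rpow_le_rpow ((by positivity : 0 ≤ x ^ κ).trans hxy) hyx (by linarith))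
  have hφ : (0 : ℝ) < k.totient := by exact_mod_cast Nat.totient_pos.2 hk
  have hφk : (k.totient : ℝ) ≤ k := by exact_mod_cast Nat.totient_le k
  have hu4 : u ≤ u ^ 4 := le_self_pow₀ hu1 (by norm_num)
  set E := primeSumCoprime f x k with hE
  have hE0 : 0 ≤ E := sum_nonneg fun p _ => by
    have := hf.nonneg p
    positivity
  set M := (2 * x) ^ (α / 10) with hM
  have hM1 : 1 ≤ M := Real.one_le_rpow (by linarith) (by positivity)
  obtain ⟨-, hMk⟩ := mul_rpow_pow_five_le hxl hl1 hα hα' hk hkx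
  have hMx : M ^ 5 ≤ x :=
    (le_mul_of_one_le_left (by positivity) (by exact_mod_cast hk)).trans hMk.le
  set h := ⌈17 * u⌉₊ with hh
  obtain ⟨hY2, hYh, -, -⟩ := two_le_floor_and_pow_le hxl hlu hu1 hα hα' hbig hh
  -- Large enough for M^(-λ) to beat u^β, small enough for exp(BU log U) to be a small power of log
  -- x.
  set U := u ^ (1 / 2 : ℝ) with hU
  have hU1 : 1 ≤ U := Real.one_le_rpow hu1 (by norm_num)
  have hUu : U ≤ u := by
    calc U ≤ u ^ (1 : ℝ) := Real.rpow_le_rpow_of_exponent_le hu1 (by norm_num)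
      _ = u := Real.rpow_one u
  have hl2 : 0 < Real.log (2 * x) := Real.log_pos (by linarith)
  set w := ⌈u ^ 4⌉₊ with hw
  have hw2 : 2 ≤ w := by
    have h1 : (1 : ℝ) < u ^ 4 := by
      have h2 : 1 < u := by
        by_contra hcon
        have h3 : u = 1 := le_antisymm (not_lt.1 hcon) hu1
        rw [h3] at hbig
        have h4 : α * Real.exp 1 ≤ 1 / 2 * Real.exp 1 :=
          mul_le_mul_of_nonneg_right hα'.le (Real.exp_pos 1).le
        linarith [Real.exp_one_lt_d9]
      exact one_lt_pow₀ h2 (by norm_num)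
    exact Nat.lt_ceil.2 (by exact_mod_cast h1)
  have hUw : U ^ 8 ≤ w := by
    have h1 : U ^ 8 = u ^ 4 := by
      rw [hU, ← Real.rpow_natCast, ← Real.rpow_mul hu0.le, ← Real.rpow_natCast]
      norm_num
    rw [h1]
    exact Nat.le_ceil _
  set lam := Real.log U / Real.log (2 * x) with hlam
  have hlam' : lam * Real.log (2 * x) = Real.log U := div_mul_cancel₀ _ hl2.ne'
  have hMlam : M ^ (-lam) = u ^ (-(α / 20)) := by
    rw [hM, ← Real.rpow_mul (by linarith), Real.rpow_def_of_pos (by linarith),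
      Real.rpow_def_of_pos hu0]
    congr 1
    calc Real.log (2 * x) * (α / 10 * -lam) = -(α / 10) * (lam * Real.log (2 * x)) := by ring
      _ = _ := by rw [hlam', hU, Real.log_rpow hu0]; ring
  have hρ : A * u ^ β * M ^ (-lam) ≤ Real.exp (-2) := by
    refine le_trans (le_of_eq ?_) hcA
    rw [hMlam, mul_assoc, ← Real.rpow_add hu0]
    congr 2
    ring
  have hρ2 : Real.exp (-2) ≤ 1 / 2 := by
    rw [Real.exp_neg, one_div]
    exact inv_anti₀ (by norm_num) (by linarith [Real.add_one_le_exp (2 : ℝ)])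
  have hB1 : 1 ≤ A * u ^ β := one_le_mul_of_one_le_of_one_le hA1 (Real.one_le_rpow hu1 hβ.le)
  have hF : ∀ n ∈ dyadicClass x k a, f n ≤ c₁ * (2 * x) ^ (α / 80) := fun n hn => by
    have hnI := mem_Icc.1 (mem_filter.1 hn).1
    have h1 : 1 ≤ ⌈x⌉₊ := Nat.one_le_ceil_iff.2 hx0
    exact hf.le_mul_rpow_of_le_two_mul hl0.le hx1 (by positivity) n (h1.trans hnI.1)
      ((Nat.le_floor_iff (by linarith)).1 hnI.2)
  set T := c₃ * u * x / (k.totient * l) with hT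
  set G := c₂ * l ^ ε * Real.exp (ε * u + E) with hG
  have main := sum_dyadicClass_le (F := c₁ * (2 * x) ^ (α / 80)) (G := G) (T := T) hx1 hk ha
    hf.isMultiplicative hf.nonneg hB1 (fun p j hp hj => hf.prime_pow_le_pow hu1 p j hp hj)
    (by positivity) hF hM1 hMk hU1 hw2 hUw hlam' hY2 hYh (by positivity) (by positivity) hρ hρ2
    (fun b hb hbk hbM => card_sifted_dyadicClass_le_of_large hxl hlu hu1 hα hα' hbig hh hk hkx a
      hb hbk hbM)
    (fun r hr S hS0 hS => sum_rankin_le_of_large hu1 hA1 hβ (by linarith) hf.isMultiplicative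
      hf.nonneg (fun p j hp hj => hf.prime_pow_le_pow hu1 p j hp hj)
      (fun n hn => hf.le_mul_rpow hl1 hε0 hε8 n hn) hcD hx1 hlam' hr S
      (fun b hb => ⟨(hS0 b hb).1, (hS0 b hb).2.trans hMx⟩) hS)
  refine (shortProgressionSum_le_sum_dyadicClass hf.nonneg hyx k a).trans (main.trans ?_)
  have hlε : l ^ ε = Real.exp (ε * u) := by
    rw [Real.rpow_def_of_pos hl0, ← hu, mul_comm]
  set V := x / (k.totient * l) with hV
  have hV0 : 0 ≤ V := by positivity
  have hW : x / (k.totient * l ^ (1 - ε₀)) * Real.exp E = V * Real.exp (ε₀ * u) * Real.exp E := by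
    have h1 : Real.exp (ε₀ * u) = l ^ ε₀ := by
      rw [Real.rpow_def_of_pos hl0, ← hu, mul_comm]
    rw [Real.rpow_sub hl0, Real.rpow_one, h1, hV]
    field_simp
  -- The trivial count loses a factor l against V; it is only used where a saving of 1/l is
  -- available.
  have hxk : 3 * x / k ≤ 3 * l * V := by
    have h1 : 3 * l * V = 3 * x / k.totient := by rw [hV]; field_simp
    rw [h1]
    exact div_le_div_of_nonneg_left (by positivity) hφ hφk
  have part1 : c₁ * (2 * x) ^ (α / 80) * (3 * x / k) *
      (2 / M + (w / M) ^ (1 / 2 : ℝ) * 4 ^ w) ≤ c₁ * 3 * (V * Real.exp (ε₀ * u) * Real.exp E) := by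
    have h1 := exceptional_le_of_large hxl hlu hu1 hα hα' hbig
    rw [← hM, ← hw] at h1
    have h2 : V ≤ V * Real.exp (ε₀ * u) * Real.exp E := by
      rw [mul_assoc, ← Real.exp_add]
      exact le_mul_of_one_le_right hV0 (Real.one_le_exp (by positivity))
    calc _ = c₁ * (3 * x / k) * ((2 * x) ^ (α / 80) *
          (2 / M + (w / M) ^ (1 / 2 : ℝ) * 4 ^ w)) := by ring
      _ ≤ c₁ * (3 * l * V) * (1 / l) := by gcongr
      _ = c₁ * 3 * V := by field_simp
      _ ≤ _ := mul_le_mul_of_nonneg_left h2 (by positivity)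
  have part2 : U * G * (2 * T + 2 * Real.exp (-2) ^ h * (3 * x / k)) ≤
      c₂ * (2 * c₃ + 6) * (V * Real.exp (ε₀ * u) * Real.exp E) := by
    have h1 : Real.exp (-2) ^ h ≤ 1 / l := by
      have h2 : 17 * u ≤ h := Nat.le_ceil _
      rw [← Real.exp_nat_mul, hlu, one_div, ← Real.exp_neg]
      exact Real.exp_le_exp.2 (by linarith)
    have h3 : 2 * T + 2 * Real.exp (-2) ^ h * (3 * x / k) ≤ (2 * c₃ + 6) * u * V := by
      have h4 : T = c₃ * u * V := by rw [hT, hV]; ring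
      calc _ ≤ 2 * (c₃ * u * V) + 2 * (1 / l) * (3 * l * V) := by rw [h4]; gcongr
        _ = 2 * (c₃ * u * V) + 6 * 1 * V := by field_simp; ring
        _ ≤ 2 * (c₃ * u * V) + 6 * u * V := by gcongr
        _ = _ := by ring
    have h5 : Real.exp (3 * (ε * u)) ≤ Real.exp (ε₀ * u) := by
      refine Real.exp_le_exp.2 ?_
      have := mul_le_mul_of_nonneg_right hεε₀ hu0.le
      have : 0 ≤ ε₀ * u := by positivity
      linarith
    calc U * G * (2 * T + 2 * Real.exp (-2) ^ h * (3 * x / k))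
        ≤ u * G * ((2 * c₃ + 6) * u * V) := by gcongr
      _ = u ^ 2 * (G * (2 * c₃ + 6) * V) := by ring
      _ ≤ Real.exp (ε * u) * (G * (2 * c₃ + 6) * V) :=
          mul_le_mul_of_nonneg_right hcu (by positivity)
      _ = c₂ * (2 * c₃ + 6) * (V * Real.exp (3 * (ε * u)) * Real.exp E) := by
          have h6 : Real.exp (3 * (ε * u)) =
              Real.exp (ε * u) * Real.exp (ε * u) * Real.exp (ε * u) := by
            rw [← Real.exp_add, ← Real.exp_add]; congr 1; ring
          rw [hG, hlε, Real.exp_add, h6]; ring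
      _ ≤ _ := by gcongr
  rw [hW]
  exact (add_le_add part1 part2).trans_eq (by ring)
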